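/- Let $f_0\in H^0(\mathcal O_{\mathbf P^n}(h))$ define a smooth hypersurface in complex projective space $\mathbf P^n$, and let $L_0,\dots,L_h\in H^0(\mathcal O_{\mathbf P^n}(1))$ be nonzero linear forms with $\mathrm{div}(L_i)\neq \mathrm{div}(L_j)$ for $i\ne j$. Put $$F(a,x)=f_0(x)+\sum_{i=0}^h a_i\,M_i(x),\qquad M_i=L_0\cdots\widehat{L_i}\cdots L_h ,$$ let $A\subset\mathbf C^{h+1}$ be the set of all $a$ for which the hypersurface $\{F(a,\cdot)=0\}\subset\mathbf P^n$ is smooth, let $W=\mathbf P^n\setminus\bigcup_{i<j}\{L_i=L_j=0\}$, and let $X_W=\{(a,x)\in A\times W: F(a,x)=0\}$. Write $(1)$ for the twist by the pull-back of $\mathcal O_{\mathbf P^n}(1)$, and let $T_{W/A}=\{0\}\oplus TW\subset T(A\times W)$ and $T_{A/W}=TA\oplus\{0\}\subset T(A\times W)$. Then the twisted vector fields $u_i=L_0\,\partial/\partial a_0-L_i\,\partial/\partial a_i$, $i=1,\dots,h$, are regular sections of $TX_W(1)$ and span a subbundle $G(1)\subset TX_W(1)$ of rank $h$. The restriction $T_{W/A}(1)|_{X_W}$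 is an algebraic vector bundle of rank $n$, and there is an isomorphism of algebraic vector bundles on $X_W$ $$I:\ TX_W(1)/G(1)\ \xrightarrow{\ \sim\ }\ T_{W/A}(1)|_{X_W},$$ which maps the class of $\tau=\alpha+v$, with $\alpha\in T_{A/W}(1)$ and $v\in T_{W/A}(1)$, to $-v$. Moreover, at every point $(0,x)$ of $X_W$ (that is, over $\{f_0\}\times(\{f_0=0\}\cap W)$), $I$ is compatible with the differential maps to $\mathcal O(h+1)$: for every $\tau\in TX_W(1)$ at this point, $$\nu(I([\tau]))=\mu(\tau),$$ where $\mu:TX_W(1)\to\mathcal O_{\mathbf P^n}(h+1)$ sends a vector with $A$-component $\sum_i\alpha_i\,\partial/\partial a_i$ to $\partial F/\partial\alpha=\sum_i\alpha_i M_i$, and $\nu(\beta)=\partial f_0/\partial\beta$ for $\beta\in TW(1)$. -/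

import Mathlib

open MvPolynomial Topology Filter
open scoped TensorProduct LinearAlgebra.Projectivization

noncomputable section

namespace ClemensFamily

/-! ### Subvarieties of `ℂ^m × ℙ^n` and their regular functions -/

/-- The points of `ℂ^m × ℙ^n`. -/
@[ext]
structure AffProj (m n : ℕ) where
  a : Fin m → ℂ
  x : ℙ ℂ (Fin (n + 1) → ℂ)

/-- Polynomials in the affine coordinates `a` and the homogeneous coordinates `x`; homogeneity
(`MvPolynomial.IsHomogeneous`) refers to `x` only. -/
abbrev BiPoly (m n : ℕ) := MvPolynomial (Fin (n + 1)) (MvPolynomial (Fin m) ℂ)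

/-- The value `P(a, w)`. -/
def ev {m n : ℕ} (P : BiPoly m n) (a : Fin m → ℂ) (w : Fin (n + 1) → ℂ) : ℂ :=
  eval w (map (eval a) P)

/-- The value at a representative of a point; the ratio of two polynomials of the same degree
in `x`, and the vanishing of one, do not depend on the representative. -/
def evp {m n : ℕ} (P : BiPoly m n) (q : AffProj m n) : ℂ := ev P q.a q.x.rep

/-- The Zariski topology. -/
instance zariskiTopology (m n : ℕ) : TopologicalSpace (AffProj m n) :=
  TopologicalSpace.generateFrom
    {U | ∃ (d : ℕ) (P : BiPoly m n), P.IsHomogeneous d ∧ U = {q | evp P q ≠ 0}}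

variable {m n : ℕ}

/-- `f` is regular at `p`: near `p` it is a ratio of polynomials, homogeneous in `x` of the same
degree. -/
def IsRegularAt (S : Set (AffProj m n)) (p : S) (f : S → ℂ) : Prop :=
  ∃ (d : ℕ) (P Q : BiPoly m n), P.IsHomogeneous d ∧ Q.IsHomogeneous d ∧ evp Q p.1 ≠ 0 ∧
    ∀ᶠ q : S in 𝓝 p, f q = evp P q.1 / evp Q q.1

lemma evp_add (P Q : BiPoly m n) (q : AffProj m n) : evp (P + Q) q = evp P q + evp Q q := by
  simp [evp, ev]

lemma evp_mul (P Q : BiPoly m n) (q : AffProj m n) : evp (P * Q) q = evp P q * evp Q q := by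
  simp [evp, ev]

lemma eventually_evp_ne {S : Set (AffProj m n)} (p : S) {d : ℕ} {Q : BiPoly m n}
    (hQ : Q.IsHomogeneous d) (h : evp Q p.1 ≠ 0) : ∀ᶠ q : S in 𝓝 p, evp Q q.1 ≠ 0 := by
  have ho : IsOpen {q : AffProj m n | evp Q q ≠ 0} :=
    TopologicalSpace.isOpen_generateFrom_of_mem ⟨d, Q, hQ, rfl⟩
  exact (ho.preimage continuous_subtype_val).mem_nhds h

/-- The functions on `S` that are regular at `p`. The local ring of `S` at `p` is the ring of
germs at `p` of its elements. -/
def regAt (S : Set (AffProj m n)) (p : S) : Subalgebra ℂ (S → ℂ) where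
  carrier := {f | IsRegularAt S p f}
  mul_mem' := by
    rintro f g ⟨d, P, Q, hP, hQ, h0, hf⟩ ⟨d', P', Q', hP', hQ', h0', hg⟩
    refine ⟨d + d', P * P', Q * Q', hP.mul hP', hQ.mul hQ', ?_, ?_⟩
    · rw [evp_mul]; exact mul_ne_zero h0 h0'
    · filter_upwards [hf, hg] with q h1 h2
      simp only [Pi.mul_apply, h1, h2, evp_mul]
      rw [div_mul_div_comm]
  add_mem' := by
    rintro f g ⟨d, P, Q, hP, hQ, h0, hf⟩ ⟨d', P', Q', hP', hQ', h0', hg⟩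
    refine ⟨d + d', P * Q' + Q * P', Q * Q', (hP.mul hQ').add (hQ.mul hP'), hQ.mul hQ', ?_, ?_⟩
    · rw [evp_mul]; exact mul_ne_zero h0 h0'
    · filter_upwards [hf, hg, eventually_evp_ne p hQ h0, eventually_evp_ne p hQ' h0']
        with q h1 h2 h3 h4
      simp only [Pi.add_apply, h1, h2, evp_mul, evp_add]
      rw [div_add_div _ _ h3 h4]
  algebraMap_mem' := by
    intro r
    refine ⟨0, C (C r), 1, isHomogeneous_C _ _, isHomogeneous_one _ _, ?_, ?_⟩
    · simp [evp, ev]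
    · exact Eventually.of_forall fun q => by simp [evp, ev]

/-- The restriction to `S ⊆ Z` of a function on `Z`, regular at a point of `S`. -/
def restrictFun {S Z : Set (AffProj m n)} (h : S ⊆ Z) (p : S) :
    regAt Z (Set.inclusion h p) →ₗ[ℂ] regAt S p where
  toFun f := ⟨fun q => f.1 (Set.inclusion h q), by
    obtain ⟨d, P, Q, hP, hQ, h0, hf⟩ := f.2
    exact ⟨d, P, Q, hP, hQ, h0, (continuous_inclusion h).continuousAt.eventually hf⟩⟩
  map_add' _ _ := rfl
  map_smul' _ _ := rfl

/-- The affine coordinate function `a_i`. -/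
def coordA (S : Set (AffProj m n)) (p : S) (i : Fin m) : regAt S p :=
  ⟨fun q => q.1.a i, 0, C (X i), 1, isHomogeneous_C _ _, isHomogeneous_one _ _, by simp [evp, ev],
    Eventually.of_forall fun q => by simp [evp, ev]⟩

/-! ### Tangent vectors -/

/-- The Zariski tangent space of `S` at `p`: the point derivations at `p`. A derivation of
`regAt S p` automatically kills the functions that vanish near `p` (such an `f` is `f * g` with
`g` the indicator function of `f ≠ 0`), so these are the derivations of the local ring. -/
def tangentSpace (S : Set (AffProj m n)) (p : S) : Submodule ℂ (Module.Dual ℂ (regAt S p)) where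
  carrier := {D | ∀ f g, D (f * g) = f.1 p * D g + g.1 p * D f}
  add_mem' := by
    intro D E hD hE f g
    simp only [LinearMap.add_apply, hD f g, hE f g]
    ring
  zero_mem' := by intro f g; simp
  smul_mem' := by
    intro c D hD f g
    simp only [LinearMap.smul_apply, hD f g, smul_eq_mul]
    ring

/-- The differential `T_p S → T_p Z` of an inclusion `S ⊆ Z`. -/
def dIncl {S Z : Set (AffProj m n)} (h : S ⊆ Z) (p : S) :
    tangentSpace S p →ₗ[ℂ] tangentSpace Z (Set.inclusion h p) where
  toFun D := ⟨D.1 ∘ₗ restrictFun h p, fun f g => D.2 (restrictFun h p f) (restrictFun h p g)⟩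
  map_add' _ _ := rfl
  map_smul' _ _ := rfl

/-- The tangent vectors at `p` along the fibre through `p` of a map `pr`: those that kill all
functions factoring through `pr`. -/
def relTangentSpace {B : Type} (pr : AffProj m n → B) (S : Set (AffProj m n)) (p : S) :
    Submodule ℂ (tangentSpace S p) where
  carrier := {D | ∀ f : regAt S p, (∃ g : B → ℂ, ∀ q, f.1 q = g (pr q.1)) → D.1 f = 0}
  add_mem' := by
    intro D E hD hE f hf
    simp [hD f hf, hE f hf]
  zero_mem' := by intro f _; rfl
  smul_mem' := by
    intro c D hD f hf
    simp [hD f hf]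

/-- The affine line through `p` in the direction of the coordinate `a_i`. -/
def lineA (p : AffProj m n) (i : Fin m) (t : ℂ) : AffProj m n := ⟨p.a + Pi.single i t, p.x⟩

lemma differentiable_evp_lineA (P : BiPoly m n) (p : AffProj m n) (i : Fin m) :
    Differentiable ℂ fun t => evp P (lineA p i t) := by
  have key : ∀ R : MvPolynomial (Fin m) ℂ,
      Differentiable ℂ fun t : ℂ => eval (p.a + Pi.single i t) R := by
    intro R
    induction R using MvPolynomial.induction_on with
    | C r => simp
    | add R R' h h' => simpa using h.fun_add h'
    | mul_X R j h =>
      simp only [map_mul, eval_X, Pi.add_apply]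
      refine h.mul ((differentiable_const _).add ?_)
      by_cases hj : j = i
      · subst hj; simp
      · simp [Pi.single_eq_of_ne hj]
  induction P using MvPolynomial.induction_on with
  | C R => simpa [evp, ev, lineA] using key R
  | add P P' h h' => simpa [evp_add] using h.fun_add h'
  | mul_X P j h =>
    simp only [evp_mul]
    refine h.mul ?_
    simp [evp, ev, lineA]

lemma continuous_lineA (p : AffProj m n) (i : Fin m) : Continuous (lineA p i) := by
  refine continuous_generateFrom_iff.2 ?_
  rintro _ ⟨d, P, _, rfl⟩
  exact isOpen_ne.preimage (differentiable_evp_lineA P p i).continuous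

lemma lineA_zero (p : AffProj m n) (i : Fin m) : lineA p i 0 = p := by
  simp [lineA]

lemma differentiableAt_lineA (p : (Set.univ : Set (AffProj m n))) (i : Fin m)
    (f : regAt Set.univ p) :
    DifferentiableAt ℂ (fun t => f.1 ⟨lineA p.1 i t, trivial⟩) 0 := by
  obtain ⟨d, P, Q, -, -, h0, hf⟩ := f.2
  have hc : Tendsto (fun t => (⟨lineA p.1 i t, trivial⟩ : (Set.univ : Set (AffProj m n))))
      (𝓝 0) (𝓝 p) := by
    have h1 := ((continuous_lineA p.1 i).subtype_mk (fun _ => Set.mem_univ _)).tendsto 0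
    have h2 : (⟨lineA p.1 i 0, trivial⟩ : (Set.univ : Set (AffProj m n))) = p :=
      Subtype.ext (lineA_zero p.1 i)
    rwa [h2] at h1
  have hd : DifferentiableAt ℂ (fun t => evp P (lineA p.1 i t) / evp Q (lineA p.1 i t)) 0 := by
    refine (differentiable_evp_lineA P p.1 i 0).div (differentiable_evp_lineA Q p.1 i 0) ?_
    rwa [lineA_zero]
  exact hd.congr_of_eventuallyEq (hc.eventually hf)

/-- The tangent vector `∂/∂a_i` of `ℂ^m × ℙ^n` at `p`. -/
def partialA (p : (Set.univ : Set (AffProj m n))) (i : Fin m) : tangentSpace Set.univ p :=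
  ⟨{ toFun := fun f => deriv (fun t => f.1 ⟨lineA p.1 i t, trivial⟩) 0
     map_add' := fun f g =>
       deriv_fun_add (differentiableAt_lineA p i f) (differentiableAt_lineA p i g)
     map_smul' := fun c f => deriv_const_mul c (differentiableAt_lineA p i f) }, by
    intro f g
    have h := deriv_fun_mul (differentiableAt_lineA p i f) (differentiableAt_lineA p i g)
    have hp : (⟨lineA p.1 i 0, trivial⟩ : (Set.univ : Set (AffProj m n))) = p :=
      Subtype.ext (lineA_zero p.1 i)
    rw [hp] at h
    refine h.trans ?_
    simp only [LinearMap.coe_mk, AddHom.coe_mk]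
    ring⟩

/-! ### Bundles

A bundle (`RegBundle`) is given by its fibres together with its regular local sections. -/

/-- A family of vector spaces over `S`, with a notion of a section being regular at a point. -/
structure RegBundle (S : Set (AffProj m n)) where
  fibre : S → Type
  [addCommGroup : ∀ p, AddCommGroup (fibre p)]
  [module : ∀ p, Module ℂ (fibre p)]
  IsRegAt : S → (∀ q, fibre q) → Prop

attribute [instance] RegBundle.addCommGroup RegBundle.module

namespace RegBundle

variable {S : Set (AffProj m n)}

/-- `E` is a vector bundle of rank `r`: near every point there is a frame in which the regular
sections are those with regular coefficients. -/
def IsLocallyFree (E : RegBundle S) (r : ℕ) : Prop :=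
  ∀ p : S, ∃ e : Fin r → ∀ q, E.fibre q, ∀ᶠ q in 𝓝 p,
    (∃ b : Module.Basis (Fin r) ℂ (E.fibre q), ∀ i, b i = e i q) ∧
    ∀ s : ∀ q, E.fibre q, E.IsRegAt q s ↔
      ∃ g : Fin r → S → ℂ, (∀ i, IsRegularAt S q (g i)) ∧
        ∀ᶠ q' in 𝓝 q, s q' = ∑ i, g i q' • e i q'

/-- Isomorphisms of bundles: fibrewise linear isomorphisms under which the regular local sections
correspond to each other. -/
structure Iso (E F : RegBundle S) where
  equiv : ∀ p, E.fibre p ≃ₗ[ℂ] F.fibre p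
  isRegAt_iff : ∀ (p : S) (s : ∀ q, E.fibre q),
    E.IsRegAt p s ↔ F.IsRegAt p (fun q => equiv q (s q))

/-- The tensor product; its regular sections are locally the finite sums of `s ⊗ t`. -/
def tensor (E F : RegBundle S) : RegBundle S where
  fibre p := E.fibre p ⊗[ℂ] F.fibre p
  IsRegAt p r := ∃ (k : ℕ) (s : Fin k → ∀ q, E.fibre q) (t : Fin k → ∀ q, F.fibre q),
    (∀ i, E.IsRegAt p (s i)) ∧ (∀ i, F.IsRegAt p (t i)) ∧
      ∀ᶠ q in 𝓝 p, r q = ∑ i, s i q ⊗ₜ[ℂ] t i q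

/-- A subbundle; its regular sections are those that are regular in the ambient bundle. -/
def sub (E : RegBundle S) (G : ∀ p, Submodule ℂ (E.fibre p)) : RegBundle S where
  fibre p := G p
  IsRegAt p s := E.IsRegAt p (fun q => (s q : E.fibre q))

/-- The quotient by a subbundle; its regular sections are locally the classes of regular
sections. -/
def quot (E : RegBundle S) (G : ∀ p, Submodule ℂ (E.fibre p)) : RegBundle S where
  fibre p := E.fibre p ⧸ G p
  IsRegAt p s := ∃ t : ∀ q, E.fibre q, E.IsRegAt p t ∧
    ∀ᶠ q in 𝓝 p, s q = Submodule.Quotient.mk (t q)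

/-- The restriction to `S ⊆ Z` of a bundle on `Z`; its regular sections are locally the
combinations of restricted regular sections with regular functions on `S` as coefficients. -/
def restrict {Z : Set (AffProj m n)} (E : RegBundle Z) (h : S ⊆ Z) : RegBundle S where
  fibre p := E.fibre (Set.inclusion h p)
  IsRegAt p r := ∃ (k : ℕ) (g : Fin k → S → ℂ) (s : Fin k → ∀ q, E.fibre q),
    (∀ i, IsRegularAt S p (g i)) ∧ (∀ i, E.IsRegAt (Set.inclusion h p) (s i)) ∧
      ∀ᶠ q in 𝓝 p, r q = ∑ i, g i q • s i (Set.inclusion h q)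

end RegBundle

open Classical in
/-- The function `q ↦ s_q(f)` (with value `0` where `f` is not regular). -/
def applyField (S : Set (AffProj m n)) (s : ∀ q, tangentSpace S q) (f : S → ℂ) : S → ℂ :=
  fun q => if h : f ∈ regAt S q then (s q).1 ⟨f, h⟩ else 0

/-- The tangent bundle; a vector field is regular if it maps regular functions to regular
functions. -/
def tangentBundle (S : Set (AffProj m n)) : RegBundle S where
  fibre p := tangentSpace S p
  IsRegAt p s := ∀ f ∈ regAt S p, IsRegularAt S p (applyField S s f)

/-- The fibre of `O(k)` at a point of `ℙ^n`: the functions on the corresponding line that are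
homogeneous of degree `k`. -/
def lineFun (k : ℕ) (x : ℙ ℂ (Fin (n + 1) → ℂ)) : Submodule ℂ (x.submodule → ℂ) where
  carrier := {s | ∀ (c : ℂ) (w : x.submodule), s (c • w) = c ^ k * s w}
  add_mem' := by
    intro s t hs ht c w
    simp only [Pi.add_apply, hs c w, ht c w]
    ring
  zero_mem' := by intro c w; simp
  smul_mem' := by
    intro r s hs c w
    simp only [Pi.smul_apply, hs c w, smul_eq_mul]
    ring

/-- The line bundle `O(k)` on `S`, pulled back from `ℙ^n`. -/
def lineBundle (k : ℕ) (S : Set (AffProj m n)) : RegBundle S where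
  fibre p := lineFun k p.1.x
  IsRegAt p s := ∃ (d : ℕ) (P Q : BiPoly m n), P.IsHomogeneous (d + k) ∧ Q.IsHomogeneous d ∧
    evp Q p.1 ≠ 0 ∧ ∀ᶠ q : S in 𝓝 p, ∀ w : q.1.x.submodule,
      (s q).1 w * ev Q q.1.a w.1 = ev P q.1.a w.1

/-- The twist `E(1)`. -/
def RegBundle.twist {S : Set (AffProj m n)} (E : RegBundle S) : RegBundle S := E.tensor (lineBundle 1 S)

/-- The subbundle of the tangent bundle of the vectors along the fibres of `pr`. On an open subset
of `ℂ^m × ℙ^n`, the projection `pr = AffProj.a` gives `{0} ⊕ Tℙ^n` and `pr = AffProj.x` gives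
`Tℂ^m ⊕ {0}`. -/
def relTangentBundle {B : Type} (pr : AffProj m n → B) (S : Set (AffProj m n)) : RegBundle S :=
  (tangentBundle S).sub (relTangentSpace pr S)

/-- The product `lineFun j × lineFun k → lineFun (j + k)`. -/
def lineMul {x : ℙ ℂ (Fin (n + 1) → ℂ)} (j k : ℕ) :
    lineFun j x →ₗ[ℂ] lineFun k x →ₗ[ℂ] lineFun (j + k) x :=
  LinearMap.mk₂ ℂ (fun s t => ⟨fun w => s.1 w * t.1 w, fun c w => by
      change s.1 (c • w) * t.1 (c • w) = c ^ (j + k) * (s.1 w * t.1 w)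
      rw [s.2 c w, t.2 c w]; ring⟩)
    (fun s s' t => Subtype.ext (funext fun w => add_mul _ _ _))
    (fun c s t => Subtype.ext (funext fun w => mul_assoc _ _ _))
    (fun s t t' => Subtype.ext (funext fun w => mul_add _ _ _))
    (fun c s t => Subtype.ext (funext fun w => mul_left_comm _ _ _))

/-! ### The family of hypersurfaces -/

/-- `H⁰(O_{ℙ^n}(k))`: the forms of degree `k` in `n + 1` variables. -/
abbrev Form (n k : ℕ) := homogeneousSubmodule (Fin (n + 1)) ℂ k

/-- The zero locus in `ℙ^n` of a form. -/
def projZeros {k : ℕ} (f : Form n k) : Set (ℙ ℂ (Fin (n + 1) → ℂ)) :=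
  {x | eval x.rep f.1 = 0}

/-- The hypersurface `f = 0` in `ℙ^n` is smooth. -/
def IsSmoothForm (f : MvPolynomial (Fin (n + 1)) ℂ) : Prop :=
  ∀ w : Fin (n + 1) → ℂ, w ≠ 0 → eval w f = 0 → ∃ j, eval w (pderiv j f) ≠ 0

lemma eval_smul_form {k : ℕ} (f : Form n k) (c : ℂ) (w : Fin (n + 1) → ℂ) :
    eval (c • w) f.1 = c ^ k * eval w f.1 := by
  have hf : f.1.IsHomogeneous k := (mem_homogeneousSubmodule k f.1).1 f.2
  rw [eval_eq, eval_eq, Finset.mul_sum]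
  refine Finset.sum_congr rfl fun d hd => ?_
  have hk : ∑ i ∈ d.support, d i = k := by
    have := hf (mem_support_iff.1 hd)
    rwa [Finsupp.weight_apply, Finsupp.sum, Finset.sum_congr rfl
      (fun i _ => by simp : ∀ i ∈ d.support, d i • (1 : Fin (n + 1) → ℕ) i = d i)] at this
  simp only [Pi.smul_apply, smul_eq_mul, mul_pow, Finset.prod_mul_distrib]
  rw [Finset.prod_pow_eq_pow_sum, hk]
  ring

/-- The value in the fibre of `O(k)` of a form of degree `k`. -/
def formAt {k : ℕ} (f : Form n k) (x : ℙ ℂ (Fin (n + 1) → ℂ)) : lineFun k x :=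
  ⟨fun w => eval w.1 f.1, fun c w => eval_smul_form f c w.1⟩

lemma evp_map_C (f : MvPolynomial (Fin (n + 1)) ℂ) (q : AffProj m n) :
    evp (map C f : BiPoly m n) q = eval q.x.rep f := by
  have : (eval q.a).comp (C : ℂ →+* MvPolynomial (Fin m) ℂ) = RingHom.id ℂ := by
    ext r; simp
  rw [evp, ev, MvPolynomial.map_map, this, MvPolynomial.map_id]

/-- The function `f / Q` on `S`, regular where `Q ≠ 0`. -/
def ratio {k : ℕ} (S : Set (AffProj m n)) (p : S) (f Q : Form n k)
    (hQ : eval p.1.x.rep Q.1 ≠ 0) : regAt S p :=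
  ⟨fun q => eval q.1.x.rep f.1 / eval q.1.x.rep Q.1, k, map C f.1, map C Q.1,
    IsHomogeneous.map ((mem_homogeneousSubmodule k f.1).1 f.2) _,
    IsHomogeneous.map ((mem_homogeneousSubmodule k Q.1).1 Q.2) _,
    by rwa [evp_map_C],
    Eventually.of_forall fun q => by rw [evp_map_C, evp_map_C]⟩

section Family

variable {h : ℕ} (f₀ : Form n h) (L : Fin (h + 1) → Form n 1)

/-- The product `L_0 ⋯ L_h` with `L_i` omitted. -/
def omitProd (i : Fin (h + 1)) : Form n h :=
  ⟨∏ j ∈ Finset.univ.erase i, (L j).1, by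
    have := IsHomogeneous.prod (Finset.univ.erase i) (fun j => (L j).1) (fun _ => 1)
      (fun j _ => (mem_homogeneousSubmodule 1 (L j).1).1 (L j).2)
    simpa [mem_homogeneousSubmodule] using this⟩

/-- The member `f_0 + ∑ a_i L_0 ⋯ L̂_i ⋯ L_h` of the family. -/
def member (a : Fin (h + 1) → ℂ) : Form n h := f₀ + ∑ i, a i • omitProd L i

/-- `A`: the parameters of the smooth hypersurfaces of the family. -/
def parA : Set (Fin (h + 1) → ℂ) := {a | IsSmoothForm (member f₀ L a).1}

/-- `W`: the complement of the union of the `{L_i = L_j = 0}`, `i < j`. -/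
def openW : Set (ℙ ℂ (Fin (n + 1) → ℂ)) :=
  {x | ∀ i j, i < j → ¬ (x ∈ projZeros (L i) ∧ x ∈ projZeros (L j))}

/-- `A × W`. -/
def prodAW : Set (AffProj (h + 1) n) := {p | p.a ∈ parA f₀ L ∧ p.x ∈ openW L}

/-- `X_W`: the part over `W` of the universal hypersurface. -/
def XW : Set (AffProj (h + 1) n) := {p | p ∈ prodAW f₀ L ∧ p.x ∈ projZeros (member f₀ L p.a)}

lemma XW_subset : XW f₀ L ⊆ prodAW f₀ L := fun _ hp => hp.1

/-- `T X_W(1)`. -/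
def TXW1 : RegBundle (XW f₀ L) := (tangentBundle (XW f₀ L)).twist

/-- The relative tangent bundle `T_{W/A}(1)` of `A × W`, restricted to `X_W`. -/
def TWA1 : RegBundle (XW f₀ L) :=
  ((relTangentBundle AffProj.a (prodAW f₀ L)).twist).restrict (XW_subset f₀ L)

/-- The relative tangent bundle `T_{A/W}(1)` of `A × W`, restricted to `X_W`. -/
def TAW1 : RegBundle (XW f₀ L) :=
  ((relTangentBundle AffProj.x (prodAW f₀ L)).twist).restrict (XW_subset f₀ L)

/-- The section `u_i = L_0 ∂/∂a_0 - L_i ∂/∂a_i`, `i = 1, …, h`, of the twisted tangent bundle of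
`ℂ^(h+1) × ℙ^n`. The index `i = 1, …, h` is `i.succ` with `i : Fin h`. -/
def uField (p : (Set.univ : Set (AffProj (h + 1) n))) (i : Fin h) :
    ((tangentBundle Set.univ).twist (S := Set.univ)).fibre p :=
  (partialA p 0 ⊗ₜ[ℂ] formAt (L 0) p.1.x - partialA p i.succ ⊗ₜ[ℂ] formAt (L i.succ) p.1.x :
    tangentSpace Set.univ p ⊗[ℂ] lineFun 1 p.1.x)

/-- The differential `T_p X_W(1) → T_p(ℂ^(h+1) × ℙ^n)(1)` of the inclusion. -/
def inclTotal (p : XW f₀ L) : (TXW1 f₀ L).fibre p →ₗ[ℂ]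
    ((tangentBundle Set.univ).twist (S := Set.univ)).fibre
      (Set.inclusion (Set.subset_univ (XW f₀ L)) p) :=
  LinearMap.rTensor (lineFun 1 p.1.x) (dIncl (Set.subset_univ (XW f₀ L)) p)

/-- The differential `T_p X_W(1) → T_p(A × W)(1)` of the inclusion. -/
def inclAW (p : XW f₀ L) : (TXW1 f₀ L).fibre p →ₗ[ℂ]
    ((tangentBundle (prodAW f₀ L)).twist).fibre (Set.inclusion (XW_subset f₀ L) p) :=
  LinearMap.rTensor (lineFun 1 p.1.x) (dIncl (XW_subset f₀ L) p)

/-- `G(1)`: the vectors of `T X_W(1)` in the span of the `u_i`. -/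
def G1 (p : XW f₀ L) : Submodule ℂ ((TXW1 f₀ L).fibre p) :=
  (Submodule.span ℂ (Set.range (uField L (Set.inclusion (Set.subset_univ (XW f₀ L)) p)))).comap
    (inclTotal f₀ L p)

/-- The inclusion `T_{W/A}(1) ⊆ T(A × W)(1)` at a point of `X_W`. -/
def inclW (p : XW f₀ L) : (TWA1 f₀ L).fibre p →ₗ[ℂ]
    ((tangentBundle (prodAW f₀ L)).twist).fibre (Set.inclusion (XW_subset f₀ L) p) :=
  LinearMap.rTensor (lineFun 1 p.1.x)
    (relTangentSpace AffProj.a (prodAW f₀ L) (Set.inclusion (XW_subset f₀ L) p)).subtype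

/-- The inclusion `T_{A/W}(1) ⊆ T(A × W)(1)` at a point of `X_W`. -/
def inclA (p : XW f₀ L) : (TAW1 f₀ L).fibre p →ₗ[ℂ]
    ((tangentBundle (prodAW f₀ L)).twist).fibre (Set.inclusion (XW_subset f₀ L) p) :=
  LinearMap.rTensor (lineFun 1 p.1.x)
    (relTangentSpace AffProj.x (prodAW f₀ L) (Set.inclusion (XW_subset f₀ L) p)).subtype

/-- The derivative of the universal polynomial along the `A`-component:
`T_p X_W → O(h)`, `D ↦ ∑ D(a_i) ∂F/∂a_i` with `∂F/∂a_i = L_0 ⋯ L̂_i ⋯ L_h`. -/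
def muOne (p : XW f₀ L) : tangentSpace (XW f₀ L) p →ₗ[ℂ] lineFun h p.1.x where
  toFun D := ∑ i, D.1 (coordA (XW f₀ L) p i) • formAt (omitProd L i) p.1.x
  map_add' D E := by simp [add_smul, Finset.sum_add_distrib]
  map_smul' c D := by simp [mul_smul, Finset.smul_sum]

/-- `μ : T X_W(1) → O(h + 1)`, the twist of `muOne`. -/
def mu (p : XW f₀ L) : (TXW1 f₀ L).fibre p →ₗ[ℂ] lineFun (h + 1) p.1.x :=
  TensorProduct.lift ((lineMul h 1).comp (muOne f₀ L p))

/-- The derivative `D ↦ ∂f_0/∂D ∈ O(h)` of the section `f_0` of `O(h)` at one of its zeros, along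
vectors `D` in `T_{W/A}`, in the local trivialization of `O(h)` by `Q`. -/
def nuOne (p : XW f₀ L) (Q : Form n h) (hQ : eval p.1.x.rep Q.1 ≠ 0) :
    relTangentSpace AffProj.a (prodAW f₀ L) (Set.inclusion (XW_subset f₀ L) p) →ₗ[ℂ]
      lineFun h p.1.x where
  toFun D := D.1.1 (ratio (prodAW f₀ L) (Set.inclusion (XW_subset f₀ L) p) f₀ Q hQ) •
    formAt Q p.1.x
  map_add' D E := by simp [add_smul]
  map_smul' c D := by simp [mul_smul]

/-- `ν : T_{W/A}(1) → O(h + 1)`, the twist of `nuOne`. -/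
def nu (p : XW f₀ L) (Q : Form n h) (hQ : eval p.1.x.rep Q.1 ≠ 0) :
    (TWA1 f₀ L).fibre p →ₗ[ℂ] lineFun (h + 1) p.1.x :=
  TensorProduct.lift ((lineMul h 1).comp (nuOne f₀ L p Q hQ))

end Family

end ClemensFamily

end

open ClemensFamily

open MvPolynomial Topology Filter
open scoped TensorProduct LinearAlgebra.Projectivization

noncomputable section

namespace ClemensFamily

/-! ### Regular functions in affine charts -/

section Charts

variable {m n : ℕ} {S : Set (AffProj m n)}

/-! In a chart `x_k ≠ 0` every regular function is a rational expression in the `a_i` and the `y_j =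
x_j / x_k`. So a point derivation is determined by its values on these coordinates (`tangent_ext`),
and a vector field is regular as soon as these values are (`isRegAt_of_coords`). Tangent vectors are
produced by differentiating regular functions along curves. On `A × W` lines in the chart give
arbitrary coordinates, since `A` and `W` are open for the classical topology. Hence `T(A × W)`
splits into its parts along `A` and `W`.

On `W` at most one `L_i` vanishes, so some `M_i = ∂F/∂a_i` is nonzero. As `F` is affine in `a_i`,
the equation of `X_W` can be solved for `a_i`, and a tangent vector of `X_W` has arbitrary
coordinates apart from that one (`exists_tangent_XW`). Therefore `α + v ↦ -v` maps `T X_W` onto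
`T_{W/A}`. Its kernel consists of the vertical vectors, those with `v = 0`, whose `A`-components are
the solutions of `∑ M_l α_l = 0`.

This hyperplane has dimension `h`. It contains the `u_i`, because `L_l M_l = L_0 ⋯ L_h` for every
`l`, and they are independent because no two of the `L_i` vanish together. So the kernel is `G(1)`
(`G1_eq_ker`), and the fibres of `I` are the induced maps on the quotient. Regular sections
correspond because the coordinate fields `∂/∂y_j` lift to regular fields on `X_W`
(`quot_isRegAt_iff`). Twisting changes nothing locally: `x_k` generates `O(1)` in the chart.

Compatibility with `μ` and `ν` is the derivative of `F / Q = 0` along `D = α + v`: at `a = 0` it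
reads `v(f_0 / Q) + ∑ α_l M_l / Q = 0` (`nuOne_negProj`). -/

lemma ev_smul {P : BiPoly m n} {d : ℕ} (hP : P.IsHomogeneous d) (a : Fin m → ℂ) (c : ℂ)
    (w : Fin (n + 1) → ℂ) : ev P a (c • w) = c ^ d * ev P a w :=
  eval_smul_form ⟨map (eval a) P, (mem_homogeneousSubmodule _ _).2 (hP.map _)⟩ c w

/-- The affine coordinate function `a_i` on `S`. -/
def affineCoord (S : Set (AffProj m n)) (i : Fin m) : S → ℂ := fun q => q.1.a i

/-- The function `f / Q` on `S`. -/
def formRatio (S : Set (AffProj m n)) {k : ℕ} (f Q : Form n k) : S → ℂ :=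
  fun q => eval q.1.x.rep f.1 / eval q.1.x.rep Q.1

/-- The homogeneous coordinate `x_j`, as a linear form. -/
def varForm (j : Fin (n + 1)) : Form n 1 := ⟨X j, (mem_homogeneousSubmodule _ _).2 (isHomogeneous_X _ _)⟩

@[simp] lemma eval_varForm (j : Fin (n + 1)) (w : Fin (n + 1) → ℂ) :
    eval w (varForm j).1 = w j := by simp [varForm]

/-- The function `x_j / x_k` on `S`. -/
def chartCoord (S : Set (AffProj m n)) (k j : Fin (n + 1)) : S → ℂ :=
  formRatio S (varForm j) (varForm k)

lemma chartCoord_apply (k j : Fin (n + 1)) (q : S) :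
    chartCoord S k j q = q.1.x.rep j / q.1.x.rep k := by simp [chartCoord, formRatio]

lemma affineCoord_mem (p : S) (i : Fin m) : affineCoord S i ∈ regAt S p := (coordA S p i).2

lemma formRatio_mem {k : ℕ} (p : S) (f Q : Form n k) (hQ : eval p.1.x.rep Q.1 ≠ 0) :
    formRatio S f Q ∈ regAt S p := (ratio S p f Q hQ).2

lemma chartCoord_mem (p : S) {k : Fin (n + 1)} (hk : p.1.x.rep k ≠ 0) (j : Fin (n + 1)) :
    chartCoord S k j ∈ regAt S p := formRatio_mem p _ _ (by simpa using hk)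

lemma IsRegularAt.congr {p : S} {f g : S → ℂ} (hf : IsRegularAt S p f) (h : f =ᶠ[𝓝 p] g) :
    IsRegularAt S p g := by
  obtain ⟨d, P, Q, hP, hQ, h0, hf⟩ := hf
  refine ⟨d, P, Q, hP, hQ, h0, ?_⟩
  filter_upwards [hf, h] with q h1 h2
  rw [← h2, h1]

lemma IsRegularAt.eventually_isRegularAt {p : S} {f : S → ℂ} (hf : IsRegularAt S p f) :
    ∀ᶠ q in 𝓝 p, IsRegularAt S q f := by
  obtain ⟨d, P, Q, hP, hQ, h0, hf⟩ := hf
  filter_upwards [hf.eventually_nhds, eventually_evp_ne p hQ h0] with q h1 h2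
  exact ⟨d, P, Q, hP, hQ, h2, h1⟩

lemma IsRegularAt.eventually_ne {p : S} {f : S → ℂ} (hf : IsRegularAt S p f) (h : f p ≠ 0) :
    ∀ᶠ q in 𝓝 p, f q ≠ 0 := by
  obtain ⟨d, P, Q, hP, hQ, h0, hf⟩ := hf
  have hp := hf.self_of_nhds
  have hP0 : evp P p.1 ≠ 0 := fun h' => h (by rw [hp, h', zero_div])
  filter_upwards [hf, eventually_evp_ne p hQ h0, eventually_evp_ne p hP hP0] with q h1 h2 h3
  rw [h1]
  exact div_ne_zero h3 h2

lemma IsRegularAt.inv {p : S} {f : S → ℂ} (hf : IsRegularAt S p f) (h : f p ≠ 0) :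
    IsRegularAt S p f⁻¹ := by
  obtain ⟨d, P, Q, hP, hQ, h0, hf⟩ := hf
  have hp := hf.self_of_nhds
  have hP0 : evp P p.1 ≠ 0 := fun h' => h (by rw [hp, h', zero_div])
  refine ⟨d, Q, P, hQ, hP, hP0, ?_⟩
  filter_upwards [hf] with q h1
  rw [Pi.inv_apply, h1, inv_div]

lemma IsRegularAt.mul {p : S} {f g : S → ℂ} (hf : IsRegularAt S p f) (hg : IsRegularAt S p g) :
    IsRegularAt S p (fun q => f q * g q) := (regAt S p).mul_mem hf hg

lemma IsRegularAt.add {p : S} {f g : S → ℂ} (hf : IsRegularAt S p f) (hg : IsRegularAt S p g) :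
    IsRegularAt S p (fun q => f q + g q) := (regAt S p).add_mem hf hg

lemma IsRegularAt.neg {p : S} {f : S → ℂ} (hf : IsRegularAt S p f) :
    IsRegularAt S p (fun q => - f q) := (regAt S p).neg_mem hf

lemma isRegularAt_const (p : S) (c : ℂ) : IsRegularAt S p (fun _ => c) :=
  (regAt S p).algebraMap_mem c

lemma IsRegularAt.sum {p : S} {ι : Type*} (s : Finset ι) {f : ι → S → ℂ}
    (hf : ∀ i ∈ s, IsRegularAt S p (f i)) : IsRegularAt S p (fun q => ∑ i ∈ s, f i q) := by
  have := (regAt S p).sum_mem (t := s) (f := f) hf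
  convert (show IsRegularAt S p (∑ i ∈ s, f i) from this) using 1
  ext q
  simp

lemma IsRegularAt.restrict {Z : Set (AffProj m n)} (h : S ⊆ Z) {p : S} {f : Z → ℂ}
    (hf : IsRegularAt Z (Set.inclusion h p) f) :
    IsRegularAt S p (fun q => f (Set.inclusion h q)) :=
  (restrictFun h p ⟨f, hf⟩).2

lemma eventually_eval_ne {k : ℕ} (p : S) (Q : Form n k) (hQ : eval p.1.x.rep Q.1 ≠ 0) :
    ∀ᶠ q : S in 𝓝 p, eval q.1.x.rep Q.1 ≠ 0 := by
  have := eventually_evp_ne (m := m) p (Q := map C Q.1)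
    (((mem_homogeneousSubmodule k Q.1).1 Q.2).map _) (by rwa [evp_map_C])
  simpa only [evp_map_C] using this

lemma eventually_rep_ne (p : S) {k : Fin (n + 1)} (hk : p.1.x.rep k ≠ 0) :
    ∀ᶠ q : S in 𝓝 p, q.1.x.rep k ≠ 0 := by
  simpa using eventually_eval_ne p (varForm k) (by simpa using hk)

lemma exists_rep_ne (x : ℙ ℂ (Fin (n + 1) → ℂ)) : ∃ k, x.rep k ≠ 0 :=
  Function.ne_iff.1 x.rep_nonzero

/-- The regular functions at a point are generated by the coordinate functions of an affine
chart. -/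
theorem regAt_induction {p : S} {k : Fin (n + 1)} (hk : p.1.x.rep k ≠ 0) {M : (S → ℂ) → Prop}
    (const : ∀ c, M fun _ => c) (affine : ∀ i, M (affineCoord S i))
    (chart : ∀ j, M (chartCoord S k j)) (add : ∀ f g, M f → M g → M (f + g))
    (mul : ∀ f g, M f → M g → M (f * g)) (inv : ∀ f, M f → f p ≠ 0 → M f⁻¹)
    (congr : ∀ f g, M f → f =ᶠ[𝓝 p] g → M g) {f : S → ℂ} (hf : IsRegularAt S p f) : M f := by
  have key1 (R : MvPolynomial (Fin m) ℂ) : M fun q => eval q.1.a R := by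
    induction R using MvPolynomial.induction_on with
    | C r => simpa using const r
    | add R R' h h' => simp only [map_add]; exact add _ _ h h'
    | mul_X R j h => simp only [map_mul, eval_X]; exact mul _ _ h (affine j)
  have key (P : BiPoly m n) : M fun q => ev P q.1.a (fun j => chartCoord S k j q) := by
    induction P using MvPolynomial.induction_on with
    | C r => simpa [ev] using key1 r
    | add R R' h h' => simp only [ev, map_add] at *; exact add _ _ h h'
    | mul_X R j h => simp only [ev, map_mul, map_X, eval_X] at *; exact mul _ _ h (chart j)
  -- Homogeneity gives `P(a, x) = x_k^d P(a, y)`; the powers of `x_k` cancel in `P / Q`, which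
  -- becomes a ratio of polynomials in the chart coordinates.
  have hom {P : BiPoly m n} {d : ℕ} (hP : P.IsHomogeneous d) (q : S) (hq : q.1.x.rep k ≠ 0) :
      evp P q.1 = q.1.x.rep k ^ d * ev P q.1.a (fun j => chartCoord S k j q) := by
    rw [← ev_smul hP, evp]
    congr 1
    ext j
    simp only [Pi.smul_apply, chartCoord_apply, smul_eq_mul]
    field_simp
  obtain ⟨d, P, Q, hP, hQ, h0, hf⟩ := hf
  refine congr _ _ (mul _ _ (key P) (inv _ (key Q) ?_)) ?_
  · rw [hom hQ p hk] at h0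
    exact right_ne_zero_of_mul h0
  · filter_upwards [hf, eventually_rep_ne p hk] with q h1 h2
    rw [h1, hom hP q h2, hom hQ q h2, mul_div_mul_left _ _ (pow_ne_zero _ h2)]
    rfl

/-! ### Tangent vectors in coordinates -/

open Classical in
/-- The value of a tangent vector at a function (`0` if the function is not regular). -/
def applyVec {p : S} (D : tangentSpace S p) (f : S → ℂ) : ℂ :=
  if h : f ∈ regAt S p then D.1 ⟨f, h⟩ else 0

lemma applyVec_of_mem {p : S} (D : tangentSpace S p) {f : S → ℂ} (h : f ∈ regAt S p) :
    applyVec D f = D.1 ⟨f, h⟩ := dif_pos h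

/-- `applyVec` as a linear form in the tangent vector. -/
def applyVecₗ (p : S) (f : S → ℂ) : tangentSpace S p →ₗ[ℂ] ℂ where
  toFun D := applyVec D f
  map_add' D E := by unfold applyVec; split_ifs <;> simp
  map_smul' c D := by unfold applyVec; split_ifs <;> simp

@[simp] lemma applyVecₗ_apply {p : S} (f : S → ℂ) (D : tangentSpace S p) :
    applyVecₗ p f D = applyVec D f := rfl

@[simp] lemma applyVec_zero {p : S} (f : S → ℂ) : applyVec (0 : tangentSpace S p) f = 0 :=
  map_zero (applyVecₗ p f)

@[simp] lemma applyVec_add {p : S} (D E : tangentSpace S p) (f : S → ℂ) :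
    applyVec (D + E) f = applyVec D f + applyVec E f := map_add (applyVecₗ p f) D E

@[simp] lemma applyVec_neg {p : S} (D : tangentSpace S p) (f : S → ℂ) :
    applyVec (-D) f = -applyVec D f := map_neg (applyVecₗ p f) D

@[simp] lemma applyVec_sub {p : S} (D E : tangentSpace S p) (f : S → ℂ) :
    applyVec (D - E) f = applyVec D f - applyVec E f := map_sub (applyVecₗ p f) D E

@[simp] lemma applyVec_smul {p : S} (c : ℂ) (D : tangentSpace S p) (f : S → ℂ) :
    applyVec (c • D) f = c * applyVec D f := map_smul (applyVecₗ p f) c D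

@[simp] lemma applyVec_sum {p : S} {ι : Type*} (s : Finset ι) (D : ι → tangentSpace S p)
    (f : S → ℂ) : applyVec (∑ i ∈ s, D i) f = ∑ i ∈ s, applyVec (D i) f :=
  map_sum (applyVecₗ p f) D s

lemma applyVec_fun_add {p : S} (D : tangentSpace S p) {f g : S → ℂ} (hf : IsRegularAt S p f)
    (hg : IsRegularAt S p g) : applyVec D (f + g) = applyVec D f + applyVec D g := by
  rw [applyVec_of_mem D (f := f + g) ((regAt S p).add_mem hf hg), applyVec_of_mem D hf,
    applyVec_of_mem D hg, ← map_add]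
  rfl

lemma applyVec_fun_mul {p : S} (D : tangentSpace S p) {f g : S → ℂ} (hf : IsRegularAt S p f)
    (hg : IsRegularAt S p g) :
    applyVec D (f * g) = f p * applyVec D g + g p * applyVec D f := by
  rw [applyVec_of_mem D (f := f * g) ((regAt S p).mul_mem hf hg), applyVec_of_mem D hf,
    applyVec_of_mem D hg]
  exact D.2 ⟨f, hf⟩ ⟨g, hg⟩

lemma applyVec_const {p : S} (D : tangentSpace S p) (c : ℂ) : applyVec D (fun _ => c) = 0 := by
  have h1 := applyVec_fun_mul D (isRegularAt_const p 1) (isRegularAt_const p 1)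
  have e1 : (fun _ : S => (1 : ℂ)) * (fun _ => 1) = fun _ => 1 := by ext; simp
  rw [e1] at h1
  have h3 : applyVec D (fun _ => 1) = 0 := by linear_combination -h1
  have e3 : (c • fun _ => (1 : ℂ) : S → ℂ) = fun _ => c := by ext; simp
  rw [applyVec_of_mem D (isRegularAt_const p 1)] at h3
  have e4 := D.1.map_smul c ⟨_, isRegularAt_const p 1⟩
  rw [h3, smul_zero] at e4
  rw [applyVec_of_mem D (isRegularAt_const p c), ← e4]
  congr 1
  ext1
  exact e3.symm

lemma applyVec_fun_sum {p : S} {ι : Type*} (D : tangentSpace S p) (s : Finset ι) {f : ι → S → ℂ}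
    (hf : ∀ i ∈ s, IsRegularAt S p (f i)) :
    applyVec D (∑ i ∈ s, f i) = ∑ i ∈ s, applyVec D (f i) := by
  classical
  induction s using Finset.induction_on with
  | empty => simp only [Finset.sum_empty]; exact applyVec_const D 0
  | insert i s hi ih =>
    have hs : IsRegularAt S p (∑ i ∈ s, f i) :=
      (regAt S p).sum_mem fun i his => hf i (Finset.mem_insert_of_mem his)
    rw [Finset.sum_insert hi, Finset.sum_insert hi,
      applyVec_fun_add D (hf i (Finset.mem_insert_self i s)) hs,
      ih fun i his => hf i (Finset.mem_insert_of_mem his)]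

/-- The indicator `u` of `f ≠ g` vanishes near `p`, so it is regular, and `f - g = u * (f - g)`.
Both factors vanish at `p`, so the Leibniz rule gives `D (f - g) = 0`. -/
lemma applyVec_congr {p : S} (D : tangentSpace S p) {f g : S → ℂ} (hf : IsRegularAt S p f)
    (h : f =ᶠ[𝓝 p] g) : applyVec D f = applyVec D g := by
  classical
  have hg := hf.congr h
  let u : S → ℂ := fun q => if f q = g q then 0 else 1
  have hu0 : (fun _ => (0 : ℂ)) =ᶠ[𝓝 p] u := by
    filter_upwards [h] with q hq
    simp [u, hq]
  have hu : IsRegularAt S p u := (isRegularAt_const p 0).congr hu0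
  have hup : u p = 0 := hu0.self_of_nhds.symm
  have hng : IsRegularAt S p (-g) := hg.neg
  have hfg : IsRegularAt S p (f + -g) := hf.add hng
  have e : u * (f + -g) = f + -g := by
    ext q
    by_cases hq : f q = g q <;> simp [u, hq]
  have hval : (f + -g) p = 0 := by simp [h.self_of_nhds]
  have h1 := applyVec_fun_mul D hu hfg
  rw [e, hup, hval, zero_mul, zero_mul, add_zero, applyVec_fun_add D hf hng] at h1
  have h2 := applyVec_fun_add D hg hng
  have e2 : g + -g = fun _ => 0 := by ext; simp
  rw [e2, applyVec_const] at h2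
  linear_combination h1 + h2

/-- Differentiate `f * f⁻¹ = 1`. This identity holds only near `p`, whence the use of
`applyVec_congr`. -/
lemma applyVec_fun_inv {p : S} (D : tangentSpace S p) {f : S → ℂ} (hf : IsRegularAt S p f)
    (h : f p ≠ 0) : applyVec D f⁻¹ = -((f p)⁻¹ * (f p)⁻¹ * applyVec D f) := by
  have h1 := applyVec_fun_mul D hf (hf.inv h)
  have h2 : (fun _ => (1 : ℂ)) =ᶠ[𝓝 p] f * f⁻¹ := by
    filter_upwards [hf.eventually_ne h] with q hq
    simp [hq]
  rw [← applyVec_congr D (isRegularAt_const p 1) h2, applyVec_const, Pi.inv_apply] at h1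
  field_simp
  field_simp at h1
  linear_combination -h1

/-- A tangent vector is determined by its values at the coordinate functions of a chart. -/
theorem tangent_ext {p : S} {k : Fin (n + 1)} (hk : p.1.x.rep k ≠ 0) {D E : tangentSpace S p}
    (ha : ∀ i, applyVec D (affineCoord S i) = applyVec E (affineCoord S i))
    (hx : ∀ j, applyVec D (chartCoord S k j) = applyVec E (chartCoord S k j)) : D = E := by
  -- Regularity is carried through the induction because the rules for sums, products and inverses
  -- require it.
  have key {f : S → ℂ} (hf : IsRegularAt S p f) :
      IsRegularAt S p f ∧ applyVec D f = applyVec E f := by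
    refine regAt_induction (M := fun f => IsRegularAt S p f ∧ applyVec D f = applyVec E f) hk
      (fun c => ⟨isRegularAt_const p c, by simp [applyVec_const]⟩)
      (fun i => ⟨affineCoord_mem p i, ha i⟩) (fun j => ⟨chartCoord_mem p hk j, hx j⟩)
      ?_ ?_ ?_ ?_ hf
    · rintro f g ⟨hf, hf'⟩ ⟨hg, hg'⟩
      exact ⟨hf.add hg, by rw [applyVec_fun_add D hf hg, applyVec_fun_add E hf hg, hf', hg']⟩
    · rintro f g ⟨hf, hf'⟩ ⟨hg, hg'⟩
      exact ⟨hf.mul hg, by rw [applyVec_fun_mul D hf hg, applyVec_fun_mul E hf hg, hf', hg']⟩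
    · rintro f ⟨hf, hf'⟩ h0
      exact ⟨hf.inv h0, by rw [applyVec_fun_inv D hf h0, applyVec_fun_inv E hf h0, hf']⟩
    · rintro f g ⟨hf, hf'⟩ hfg
      exact ⟨hf.congr hfg, by rw [← applyVec_congr D hf hfg, ← applyVec_congr E hf hfg, hf']⟩
  ext f
  have := (key f.2).2
  rwa [applyVec_of_mem D f.2, applyVec_of_mem E f.2] at this

/-- `x_k / x_k` is `1` near `p`, though it takes the default value `0` where `x_k` vanishes. -/
lemma chartCoord_self {p : S} {k : Fin (n + 1)} (hk : p.1.x.rep k ≠ 0) (D : tangentSpace S p) :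
    applyVec D (chartCoord S k k) = 0 := by
  rw [← applyVec_const D 1]
  refine applyVec_congr D (chartCoord_mem p hk k) ?_
  filter_upwards [eventually_rep_ne p hk] with q hq
  rw [chartCoord_apply, div_self hq]

/-- A vector field is regular if its values at the coordinate functions of a chart are. -/
theorem isRegAt_of_coords {p : S} {k : Fin (n + 1)} (hk : p.1.x.rep k ≠ 0)
    {s : ∀ q, tangentSpace S q}
    (ha : ∀ i, IsRegularAt S p fun q => applyVec (s q) (affineCoord S i))
    (hx : ∀ j, IsRegularAt S p fun q => applyVec (s q) (chartCoord S k j)) :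
    (tangentBundle S).IsRegAt p s := by
  intro f hf
  refine (regAt_induction (M := fun f => IsRegularAt S p f ∧
    IsRegularAt S p fun q => applyVec (s q) f) hk ?_
      (fun i => ⟨affineCoord_mem p i, ha i⟩) (fun j => ⟨chartCoord_mem p hk j, hx j⟩)
      ?_ ?_ ?_ ?_ hf).2
  · intro c
    exact ⟨isRegularAt_const p c, by simpa [applyVec_const] using isRegularAt_const p 0⟩
  · rintro f g ⟨hf, hf'⟩ ⟨hg, hg'⟩
    refine ⟨hf.add hg, (hf'.add hg').congr ?_⟩
    -- The rules of calculus are needed at all `q` near `p`. They hold where the functions are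
    -- regular, which is an open condition; elsewhere `applyVec` is the default `0`.
    filter_upwards [hf.eventually_isRegularAt, hg.eventually_isRegularAt] with q h1 h2
    rw [applyVec_fun_add _ h1 h2]
  · rintro f g ⟨hf, hf'⟩ ⟨hg, hg'⟩
    refine ⟨hf.mul hg, ((hf.mul hg').add (hg.mul hf')).congr ?_⟩
    filter_upwards [hf.eventually_isRegularAt, hg.eventually_isRegularAt] with q h1 h2
    rw [applyVec_fun_mul _ h1 h2]
  · rintro f ⟨hf, hf'⟩ h0
    refine ⟨hf.inv h0, (((hf.inv h0).mul (hf.inv h0)).mul hf').neg.congr ?_⟩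
    filter_upwards [hf.eventually_isRegularAt, hf.eventually_ne h0] with q h1 h2
    rw [applyVec_fun_inv _ h1 h2]
    rfl
  · rintro f g ⟨hf, hf'⟩ hfg
    refine ⟨hf.congr hfg, hf'.congr ?_⟩
    filter_upwards [hf.eventually_isRegularAt, hfg.eventually_nhds] with q h1 h2
    exact applyVec_congr _ h1 h2

lemma isRegularAt_applyVec {p : S} {s : ∀ q, tangentSpace S q} (hs : (tangentBundle S).IsRegAt p s)
    {f : S → ℂ} (hf : IsRegularAt S p f) : IsRegularAt S p fun q => applyVec (s q) f := hs f hf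

lemma applyVec_dIncl {Z : Set (AffProj m n)} (h : S ⊆ Z) (p : S) (D : tangentSpace S p)
    {f : Z → ℂ} (hf : IsRegularAt Z (Set.inclusion h p) f) :
    applyVec (dIncl h p D) f = applyVec D fun q => f (Set.inclusion h q) := by
  rw [applyVec_of_mem _ hf, applyVec_of_mem D (hf.restrict h)]
  rfl

/-- The coordinate functions on `S` are restrictions of those on `Z`, and they determine a tangent
vector of `S`. -/
lemma dIncl_injective {Z : Set (AffProj m n)} (h : S ⊆ Z) (p : S) :
    Function.Injective (dIncl h p) := by
  intro D E hDE
  obtain ⟨k, hk⟩ := exists_rep_ne p.1.x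
  refine tangent_ext hk (fun i => ?_) (fun j => ?_)
  · have h1 := applyVec_dIncl h p D (affineCoord_mem (S := Z) _ i)
    have h2 := applyVec_dIncl h p E (affineCoord_mem (S := Z) _ i)
    rw [hDE] at h1
    exact h1.symm.trans h2
  · have h1 := applyVec_dIncl h p D (chartCoord_mem (S := Z) (Set.inclusion h p) hk j)
    have h2 := applyVec_dIncl h p E (chartCoord_mem (S := Z) (Set.inclusion h p) hk j)
    rw [hDE] at h1
    exact h1.symm.trans h2

end Charts

/-! ### Tangent vectors of curves -/

section Curves

variable {m n : ℕ} {S : Set (AffProj m n)}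

open Classical in
/-- The point `(a, [w])`. -/
def projPoint (a : Fin m → ℂ) (w : Fin (n + 1) → ℂ) : AffProj m n :=
  ⟨a, if hw : w ≠ 0 then .mk ℂ w hw else .mk ℂ 1 one_ne_zero⟩

lemma exists_rep_projPoint (a : Fin m → ℂ) {w : Fin (n + 1) → ℂ} (hw : w ≠ 0) :
    ∃ c : ℂ, c ≠ 0 ∧ (projPoint a w).x.rep = c • w := by
  obtain ⟨c, hc⟩ := Projectivization.exists_smul_eq_mk_rep ℂ w hw
  refine ⟨c, c.ne_zero, ?_⟩
  rw [projPoint, dif_pos hw, ← hc]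
  rfl

lemma projPoint_rep (p : AffProj m n) : projPoint p.a p.x.rep = p := by
  ext1
  · rfl
  · simp [projPoint, p.x.rep_nonzero]

lemma eval_rep_projPoint_eq_zero_iff {d : ℕ} (f : Form n d) (a : Fin m → ℂ) {w : Fin (n + 1) → ℂ}
    (hw : w ≠ 0) : eval (projPoint a w).x.rep f.1 = 0 ↔ eval w f.1 = 0 := by
  obtain ⟨c, hc, h⟩ := exists_rep_projPoint a hw
  rw [h, eval_smul_form]
  simp [hc]

lemma formRatio_projPoint {d : ℕ} (f Q : Form n d) (a : Fin m → ℂ) {w : Fin (n + 1) → ℂ}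
    (hw : w ≠ 0) (h : projPoint a w ∈ S) :
    formRatio S f Q ⟨projPoint a w, h⟩ = eval w f.1 / eval w Q.1 := by
  obtain ⟨c, hc, h⟩ := exists_rep_projPoint a hw
  rw [formRatio, h, eval_smul_form, eval_smul_form, mul_div_mul_left _ _ (pow_ne_zero _ hc)]

lemma differentiableAt_eval {σ : Type*} [Fintype σ] (f : MvPolynomial σ ℂ) {w : ℂ → σ → ℂ} {t : ℂ}
    (hw : DifferentiableAt ℂ w t) : DifferentiableAt ℂ (fun t => eval (w t) f) t := by
  induction f using MvPolynomial.induction_on with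
  | C r => simp
  | add R R' h h' => simpa using h.fun_add h'
  | mul_X R j h =>
    simp only [map_mul, eval_X]
    exact h.mul (differentiableAt_pi.1 hw j)

lemma differentiableAt_ev (P : BiPoly m n) {a : ℂ → Fin m → ℂ} {w : ℂ → Fin (n + 1) → ℂ} {t : ℂ}
    (ha : DifferentiableAt ℂ a t) (hw : DifferentiableAt ℂ w t) :
    DifferentiableAt ℂ (fun t => ev P (a t) (w t)) t := by
  induction P using MvPolynomial.induction_on with
  | C r => simpa [ev] using differentiableAt_eval r ha
  | add R R' h h' => simp only [ev, map_add] at *; exact h.fun_add h'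
  | mul_X R j h =>
    simp only [ev, map_mul, map_X, eval_X] at *
    exact h.mul (differentiableAt_pi.1 hw j)

open Classical in
/-- The extension by `0` of a function on `S`. -/
def extendZero (f : S → ℂ) (q : AffProj m n) : ℂ := if h : q ∈ S then f ⟨q, h⟩ else 0

lemma extendZero_of_mem (f : S → ℂ) {q : AffProj m n} (h : q ∈ S) : extendZero f q = f ⟨q, h⟩ :=
  dif_pos h

section Curve

variable {p : S} {a : ℂ → Fin m → ℂ} {w : ℂ → Fin (n + 1) → ℂ}

lemma eventually_ne_zero_of_rep (hw : ContinuousAt w 0) (hw0 : w 0 = p.1.x.rep) :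
    ∀ᶠ t in 𝓝 0, w t ≠ 0 :=
  hw.eventually_ne (by rw [hw0]; exact p.1.x.rep_nonzero)

/-- Differentiable curves are continuous for the Zariski topology at `t = 0`: a generating open set
is the locus `P ≠ 0`, and `P(a(t), w(t))` is continuous there. Changing the representative only
multiplies the value by a nonzero `c ^ d`. -/
lemma tendsto_projPoint (ha : DifferentiableAt ℂ a 0) (hw : DifferentiableAt ℂ w 0)
    (ha0 : a 0 = p.1.a) (hw0 : w 0 = p.1.x.rep) :
    Tendsto (fun t => projPoint (a t) (w t)) (𝓝 0) (𝓝 p.1) := by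
  refine TopologicalSpace.tendsto_nhds_generateFrom_iff.2 ?_
  rintro _ ⟨d, P, hP, rfl⟩ (hp : evp P p.1 ≠ 0)
  have hc := (differentiableAt_ev P ha hw).continuousAt
  have h0 : ev P (a 0) (w 0) ≠ 0 := by rwa [ha0, hw0]
  filter_upwards [hc.eventually_ne h0, eventually_ne_zero_of_rep hw.continuousAt hw0] with t h1 h2
  obtain ⟨c, hc, h⟩ := exists_rep_projPoint (a t) h2
  change ev P (a t) (projPoint (a t) (w t)).x.rep ≠ 0
  rw [h, ev_smul hP]
  exact mul_ne_zero (pow_ne_zero _ hc) h1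

/-- The curve converges to `p` in the Zariski topology, so it enters the neighbourhood on which `f =
P / Q`, and `P / Q` along the curve is a quotient of differentiable functions. -/
lemma differentiableAt_extendZero (ha : DifferentiableAt ℂ a 0) (hw : DifferentiableAt ℂ w 0)
    (ha0 : a 0 = p.1.a) (hw0 : w 0 = p.1.x.rep) (hS : ∀ᶠ t in 𝓝 0, projPoint (a t) (w t) ∈ S)
    {f : S → ℂ} (hf : IsRegularAt S p f) :
    DifferentiableAt ℂ (fun t => extendZero f (projPoint (a t) (w t))) 0 := by
  obtain ⟨d, P, Q, hP, hQ, h0, hf⟩ := hf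
  rw [nhds_subtype, eventually_comap] at hf
  have hd : DifferentiableAt ℂ (fun t => ev P (a t) (w t) / ev Q (a t) (w t)) 0 := by
    refine (differentiableAt_ev P ha hw).div (differentiableAt_ev Q ha hw) ?_
    rwa [ha0, hw0]
  refine hd.congr_of_eventuallyEq ?_
  filter_upwards [hS, (tendsto_projPoint ha hw ha0 hw0).eventually hf,
    eventually_ne_zero_of_rep hw.continuousAt hw0] with t h1 h2 h3
  obtain ⟨c, hc, h⟩ := exists_rep_projPoint (a t) h3
  rw [extendZero_of_mem f h1, h2 ⟨_, h1⟩ rfl, evp, evp, h, ev_smul hP, ev_smul hQ,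
    mul_div_mul_left _ _ (pow_ne_zero _ hc)]
  rfl

/-- The tangent vector of a curve in `S`. -/
theorem exists_tangent_of_curve (ha : DifferentiableAt ℂ a 0) (hw : DifferentiableAt ℂ w 0)
    (ha0 : a 0 = p.1.a) (hw0 : w 0 = p.1.x.rep) (hS : ∀ᶠ t in 𝓝 0, projPoint (a t) (w t) ∈ S) :
    ∃ D : tangentSpace S p, ∀ f, IsRegularAt S p f →
      HasDerivAt (fun t => extendZero f (projPoint (a t) (w t))) (applyVec D f) 0 := by
  have hd {f : S → ℂ} (hf : IsRegularAt S p f) :=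
    differentiableAt_extendZero ha hw ha0 hw0 hS hf
  have hp (f : S → ℂ) : extendZero f (projPoint (a 0) (w 0)) = f p := by
    rw [ha0, hw0, projPoint_rep, extendZero_of_mem f p.2]
  have hadd (f g : S → ℂ) (q) : extendZero (f + g) q = extendZero f q + extendZero g q := by
    unfold extendZero; split_ifs <;> simp
  have hmul (f g : S → ℂ) (q) : extendZero (f * g) q = extendZero f q * extendZero g q := by
    unfold extendZero; split_ifs <;> simp
  have hsmul (c : ℂ) (f : S → ℂ) (q) : extendZero (c • f) q = c * extendZero f q := by
    unfold extendZero; split_ifs <;> simp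
  refine ⟨⟨{ toFun := fun f => deriv (fun t => extendZero f.1 (projPoint (a t) (w t))) 0
             map_add' := fun f g => ?_
             map_smul' := fun c f => ?_ }, fun f g => ?_⟩, fun f hf => ?_⟩
  · change deriv (fun t => extendZero (f.1 + g.1) _) 0 = _
    simp only [hadd]
    exact deriv_fun_add (hd f.2) (hd g.2)
  · change deriv (fun t => extendZero (c • f.1) _) 0 = _
    simp only [hsmul]
    exact deriv_const_mul c (hd f.2)
  · change deriv (fun t => extendZero (f.1 * g.1) _) 0 = _
    simp only [hmul]
    rw [deriv_fun_mul (hd f.2) (hd g.2), hp, hp]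
    simp only [LinearMap.coe_mk, AddHom.coe_mk]
    ring
  · rw [applyVec_of_mem _ hf]
    exact (hd hf).hasDerivAt

end Curve

end Curves

/-! ### Tangent spaces of `A × W` and `X_W` -/

section Lines

variable {m n : ℕ} {S : Set (AffProj m n)}

/-- The tangent vector with given coordinates, from a curve that is a line in a chart of `ℙ^n`. -/
theorem exists_tangent_of_line {p : S} {k : Fin (n + 1)} (hk : p.1.x.rep k ≠ 0)
    {a : ℂ → Fin m → ℂ} {α : Fin m → ℂ} (ha : HasDerivAt a α 0) (ha0 : a 0 = p.1.a)
    {η : Fin (n + 1) → ℂ} (hη : η k = 0)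
    (hS : ∀ᶠ t : ℂ in 𝓝 0, projPoint (a t) (p.1.x.rep + t • p.1.x.rep k • η) ∈ S) :
    ∃ D : tangentSpace S p, (∀ i, applyVec D (affineCoord S i) = α i) ∧
      (∀ j, applyVec D (chartCoord S k j) = η j) ∧ ∀ f, IsRegularAt S p f →
      HasDerivAt (fun t : ℂ => extendZero f (projPoint (a t) (p.1.x.rep + t • p.1.x.rep k • η)))
        (applyVec D f) 0 := by
  have hw : DifferentiableAt ℂ (fun t : ℂ => p.1.x.rep + t • p.1.x.rep k • η) 0 := by fun_prop
  have hw0 : p.1.x.rep + (0 : ℂ) • p.1.x.rep k • η = p.1.x.rep := by simp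
  obtain ⟨D, hD⟩ := exists_tangent_of_curve (p := p) ha.differentiableAt hw ha0 hw0 hS
  refine ⟨D, fun i => ?_, fun j => ?_, hD⟩
  · refine (hD _ (affineCoord_mem p i)).unique ((hasDerivAt_pi.1 ha i).congr_of_eventuallyEq ?_)
    filter_upwards [hS] with t h
    rw [extendZero_of_mem _ h]
    rfl
  · have h1 : HasDerivAt (fun t : ℂ => p.1.x.rep j / p.1.x.rep k + t * η j) (η j) 0 := by
      simpa using ((hasDerivAt_id (0 : ℂ)).mul_const (η j)).const_add (p.1.x.rep j / p.1.x.rep k)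
    refine (hD _ (chartCoord_mem p hk j)).unique (h1.congr_of_eventuallyEq ?_)
    filter_upwards [hS, eventually_ne_zero_of_rep hw.continuousAt hw0] with t h h'
    rw [extendZero_of_mem _ h, chartCoord, formRatio_projPoint _ _ _ h' h]
    simp only [eval_varForm, Pi.add_apply, Pi.smul_apply, smul_eq_mul, hη]
    field_simp
    ring

end Lines

/-! ### Openness of `A` and `W` -/

section Family

variable {n h : ℕ} (f₀ : Form n h) (L : Fin (h + 1) → Form n 1)

lemma eval_member (a : Fin (h + 1) → ℂ) (w : Fin (n + 1) → ℂ) :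
    eval w (member f₀ L a).1 = eval w f₀.1 + ∑ i, a i * eval w (omitProd L i).1 := by
  simp [member]

lemma eval_pderiv_member (a : Fin (h + 1) → ℂ) (w : Fin (n + 1) → ℂ) (j : Fin (n + 1)) :
    eval w (pderiv j (member f₀ L a).1) =
      eval w (pderiv j f₀.1) + ∑ i, a i * eval w (pderiv j (omitProd L i).1) := by
  simp [member]

lemma eval_omitProd (i : Fin (h + 1)) (w : Fin (n + 1) → ℂ) :
    eval w (omitProd L i).1 = ∏ j ∈ Finset.univ.erase i, eval w (L j).1 := by
  simp [omitProd]

/-- Smoothness is an open condition, since the unit sphere is compact. -/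
lemma isOpen_parA : IsOpen (parA f₀ L) := by
  let K := Metric.sphere (0 : Fin (n + 1) → ℂ) 1
  let Z : Set ((Fin (h + 1) → ℂ) × K) :=
    {z | eval z.2.1 (member f₀ L z.1).1 = 0 ∧ ∀ j, eval z.2.1 (pderiv j (member f₀ L z.1).1) = 0}
  have hcont (g : MvPolynomial (Fin (n + 1)) ℂ) :
      Continuous fun z : (Fin (h + 1) → ℂ) × K => eval z.2.1 g :=
    g.continuous_eval.comp (continuous_subtype_val.comp continuous_snd)
  have hcoord (i : Fin (h + 1)) : Continuous fun z : (Fin (h + 1) → ℂ) × K => z.1 i :=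
    (continuous_apply i).comp continuous_fst
  have hZ : IsClosed Z := by
    have hZ' : Z = {z | eval z.2.1 (member f₀ L z.1).1 = 0} ∩
        ⋂ j, {z | eval z.2.1 (pderiv j (member f₀ L z.1).1) = 0} := by
      ext z
      simp [Z]
    rw [hZ']
    refine IsClosed.inter (isClosed_eq ?_ continuous_const) (isClosed_iInter ?_)
    · simp only [eval_member]
      exact (hcont _).add (continuous_finsetSum _ fun i _ => (hcoord i).mul (hcont _))
    · intro j
      refine isClosed_eq ?_ continuous_const
      simp only [eval_pderiv_member]
      exact (hcont _).add (continuous_finsetSum _ fun i _ => (hcoord i).mul (hcont _))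
  have hcl := isClosedMap_fst_of_compactSpace _ hZ
  have : parA f₀ L = (Prod.fst '' Z)ᶜ := by
    ext a
    simp only [parA, IsSmoothForm, Set.mem_ofPred_eq, Set.mem_compl_iff]
    refine ⟨?_, fun ha w hw0 hw => ?_⟩
    · rintro ha ⟨⟨_, w⟩, ⟨hw, hw'⟩, rfl⟩
      have : w.1 ≠ 0 := ne_zero_of_mem_unit_sphere w
      obtain ⟨j, hj⟩ := ha w.1 this hw
      exact hj (hw' j)
    · by_contra! hall
      have hn : (‖w‖ : ℂ) ≠ 0 := by simpa using hw0
      -- A singular point may be normalized to the unit sphere, because the form and its partial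
      -- derivatives are homogeneous.
      refine ha ⟨⟨a, ⟨(‖w‖ : ℂ)⁻¹ • w, ?_⟩⟩, ⟨?_, fun j => ?_⟩, rfl⟩
      · simp [K, norm_smul, hw0]
      · simp only [eval_smul_form, hw, mul_zero]
      · have := eval_smul_form ⟨pderiv j (member f₀ L a).1, (mem_homogeneousSubmodule _ _).2
          (((mem_homogeneousSubmodule _ _).1 (member f₀ L a).2).pderiv)⟩ (‖w‖ : ℂ)⁻¹ w
        simp only [this, hall j, mul_zero]
  rw [this]
  exact hcl.isOpen_compl

variable {L} in
-- For each of the finitely many pairs, one of the two linear forms is nonzero at `x` and stays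
-- nonzero along the curve by continuity.
lemma eventually_mem_openW {a : ℂ → Fin (h + 1) → ℂ} {w : ℂ → Fin (n + 1) → ℂ}
    (hw : ContinuousAt w 0) {x : ℙ ℂ (Fin (n + 1) → ℂ)} (hx : x ∈ openW L) (hw0 : w 0 = x.rep) :
    ∀ᶠ t in 𝓝 0, (projPoint (a t) (w t)).x ∈ openW L := by
  have hne : ∀ᶠ t in 𝓝 0, w t ≠ 0 := hw.eventually_ne (by rw [hw0]; exact x.rep_nonzero)
  have hL (i : Fin (h + 1)) (hi : eval x.rep (L i).1 ≠ 0) :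
      ∀ᶠ t in 𝓝 0, eval (projPoint (a t) (w t)).x.rep (L i).1 ≠ 0 := by
    have hc : ContinuousAt (fun t => eval (w t) (L i).1) 0 :=
      (MvPolynomial.continuous_eval _).continuousAt.comp hw
    filter_upwards [hne, hc.eventually_ne (by rwa [hw0])] with t h1 h2
    rwa [Ne, eval_rep_projPoint_eq_zero_iff _ _ h1]
  refine eventually_all.2 fun i => eventually_all.2 fun j => ?_
  by_cases hij : i < j
  · rcases not_and_or.1 (hx i j hij) with h1 | h1
    · filter_upwards [hL i h1] with t ht _ h'
      exact ht h'.1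
    · filter_upwards [hL j h1] with t ht _ h'
      exact ht h'.2
  · exact Eventually.of_forall fun t h' => absurd h' hij

/-! ### Tangent vectors of `A × W` -/

section AW

variable {f₀ L} {p : prodAW f₀ L} {k : Fin (n + 1)}

/-- Tangent vectors of `A × W` have arbitrary coordinates. -/
theorem exists_tangent_prodAW (hk : p.1.x.rep k ≠ 0) (α : Fin (h + 1) → ℂ) {η : Fin (n + 1) → ℂ}
    (hη : η k = 0) :
    ∃ D : tangentSpace (prodAW f₀ L) p, (∀ i, applyVec D (affineCoord _ i) = α i) ∧
      (∀ j, applyVec D (chartCoord _ k j) = η j) ∧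
      (α = 0 → D ∈ relTangentSpace AffProj.a (prodAW f₀ L) p) ∧
      (η = 0 → D ∈ relTangentSpace AffProj.x (prodAW f₀ L) p) := by
  have ha : HasDerivAt (fun t : ℂ => p.1.a + t • α) α 0 := by
    simpa using ((hasDerivAt_id (0 : ℂ)).smul_const α).const_add p.1.a
  have ha0 : p.1.a + (0 : ℂ) • α = p.1.a := by simp
  have hw : ContinuousAt (fun t : ℂ => p.1.x.rep + t • p.1.x.rep k • η) 0 := by fun_prop
  have hw0 : p.1.x.rep + (0 : ℂ) • p.1.x.rep k • η = p.1.x.rep := by simp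
  have hS : ∀ᶠ t : ℂ in 𝓝 0, projPoint (p.1.a + t • α) (p.1.x.rep + t • p.1.x.rep k • η) ∈
      prodAW f₀ L := by
    have h1 : ∀ᶠ t : ℂ in 𝓝 0, p.1.a + t • α ∈ parA f₀ L :=
      ha.continuousAt.eventually_mem ((isOpen_parA f₀ L).mem_nhds (by rw [ha0]; exact p.2.1))
    filter_upwards [h1, eventually_mem_openW (a := fun t : ℂ => p.1.a + t • α) hw p.2.2 hw0]
      with t ht ht'
    exact ⟨ht, ht'⟩
  obtain ⟨D, hDa, hDx, hD⟩ := exists_tangent_of_line hk ha ha0 hη hS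
  refine ⟨D, hDa, hDx, ?_, ?_⟩
  -- For `α = 0` the curve stays in one fibre of the projection to `A`, so a function factoring
  -- through that projection is constant along it. The case `η = 0` is symmetric.
  · rintro rfl f ⟨g, hg⟩
    rw [← applyVec_of_mem D f.2]
    refine (hD f.1 f.2).unique ((hasDerivAt_const 0 (g p.1.a)).congr_of_eventuallyEq ?_)
    filter_upwards [hS] with t ht
    rw [extendZero_of_mem _ ht, hg]
    simp [projPoint]
  · rintro rfl f ⟨g, hg⟩
    rw [← applyVec_of_mem D f.2]
    refine (hD f.1 f.2).unique ((hasDerivAt_const 0 (g p.1.x)).congr_of_eventuallyEq ?_)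
    filter_upwards [hS] with t ht
    rw [extendZero_of_mem _ ht, hg]
    simp [projPoint, p.1.x.rep_nonzero]

/-- Killing the `a_i` suffices to kill every function of `a`: `D` then has the same coordinates as
the tangent vector of a curve inside the fibre, so it equals that vector. -/
lemma mem_relTangentSpace_a {D : tangentSpace (prodAW f₀ L) p} :
    D ∈ relTangentSpace AffProj.a (prodAW f₀ L) p ↔ ∀ i, applyVec D (affineCoord _ i) = 0 := by
  refine ⟨fun hD i => ?_, fun hD => ?_⟩
  · rw [applyVec_of_mem D (affineCoord_mem p i)]
    exact hD _ ⟨fun a => a i, fun q => rfl⟩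
  · obtain ⟨k, hk⟩ := exists_rep_ne p.1.x
    obtain ⟨E, hEa, hEx, hE, -⟩ := exists_tangent_prodAW (p := p) hk 0
      (η := fun j => applyVec D (chartCoord _ k j)) (chartCoord_self hk D)
    rw [tangent_ext hk (D := D) (E := E) (fun i => by rw [hEa, hD i]; rfl) fun j => (hEx j).symm]
    exact hE rfl

lemma mem_relTangentSpace_x (hk : p.1.x.rep k ≠ 0) {D : tangentSpace (prodAW f₀ L) p} :
    D ∈ relTangentSpace AffProj.x (prodAW f₀ L) p ↔ ∀ j, applyVec D (chartCoord _ k j) = 0 := by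
  refine ⟨fun hD j => ?_, fun hD => ?_⟩
  · rw [applyVec_of_mem D (chartCoord_mem p hk j)]
    exact hD _ ⟨fun x => x.rep j / x.rep k, fun q => chartCoord_apply k j q⟩
  · obtain ⟨E, hEa, hEx, -, hE⟩ := exists_tangent_prodAW (p := p) hk
      (fun i => applyVec D (affineCoord _ i)) (η := 0) rfl
    rw [tangent_ext hk (D := D) (E := E) (fun i => (hEa i).symm) fun j => by rw [hEx, hD j]; rfl]
    exact hE rfl

lemma applyVec_formRatio_of_mem {D : tangentSpace (prodAW f₀ L) p}
    (hD : D ∈ relTangentSpace AffProj.x (prodAW f₀ L) p) {d : ℕ} (f Q : Form n d)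
    (hQ : eval p.1.x.rep Q.1 ≠ 0) : applyVec D (formRatio _ f Q) = 0 := by
  rw [applyVec_of_mem D (formRatio_mem p f Q hQ)]
  exact hD _ ⟨fun x => eval x.rep f.1 / eval x.rep Q.1, fun q => rfl⟩

/-- `T(A × W)` is the direct sum of its parts along `W` and along `A`. -/
lemma isCompl_relTangentSpace : IsCompl (relTangentSpace AffProj.a (prodAW f₀ L) p)
    (relTangentSpace AffProj.x (prodAW f₀ L) p) := by
  obtain ⟨k, hk⟩ := exists_rep_ne p.1.x
  refine ⟨Submodule.disjoint_def.2 fun D ha hx => ?_, codisjoint_iff.2 ?_⟩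
  · rw [mem_relTangentSpace_a] at ha
    rw [mem_relTangentSpace_x hk] at hx
    exact tangent_ext hk (by simpa using ha) (by simpa using hx)
  · refine eq_top_iff.2 fun D _ => ?_
    obtain ⟨E, hEa, hEx, hE, -⟩ := exists_tangent_prodAW (p := p) hk 0
      (η := fun j => applyVec D (chartCoord _ k j)) (chartCoord_self hk D)
    refine Submodule.mem_sup.2 ⟨E, hE rfl, D - E, ?_, by abel⟩
    rw [mem_relTangentSpace_x hk]
    intro j
    simp [hEx]

end AW

/-! ### Tangent vectors of `X_W` -/

section X

variable {f₀ L} {p : XW f₀ L} {k : Fin (n + 1)}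

/-- Apply the Leibniz rule to `F / Q`, which is identically zero on `X_W`. Division by `Q` turns the
section `F` of `O(h)` into a function. -/
lemma applyVec_equation (D : tangentSpace (XW f₀ L) p) (Q : Form n h)
    (hQ : eval p.1.x.rep Q.1 ≠ 0) :
    applyVec D (formRatio _ f₀ Q) + ∑ l, (p.1.a l * applyVec D (formRatio _ (omitProd L l) Q) +
      eval p.1.x.rep (omitProd L l).1 / eval p.1.x.rep Q.1 * applyVec D (affineCoord _ l)) = 0 := by
  have hz : formRatio _ f₀ Q + ∑ l, affineCoord _ l * formRatio _ (omitProd L l) Q =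
      (fun _ => 0 : XW f₀ L → ℂ) := by
    ext q
    have hq : eval q.1.x.rep (member f₀ L q.1.a).1 = 0 := q.2.2
    rw [eval_member] at hq
    simp only [Pi.add_apply, Finset.sum_apply, Pi.mul_apply, formRatio, affineCoord,
      ← mul_div_assoc]
    rw [← Finset.sum_div, ← add_div, hq, zero_div]
  have h0 := applyVec_const D 0
  have hr (l) : IsRegularAt (XW f₀ L) p (affineCoord _ l * formRatio _ (omitProd L l) Q) :=
    (affineCoord_mem p l).mul (formRatio_mem p _ Q hQ)
  rw [← hz, applyVec_fun_add D (formRatio_mem p _ Q hQ) ((regAt _ p).sum_mem fun l _ => hr l),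
    applyVec_fun_sum D _ fun l _ => hr l] at h0
  rw [← h0]
  congr 1
  refine Finset.sum_congr rfl fun l _ => ?_
  rw [applyVec_fun_mul D (affineCoord_mem p l) (formRatio_mem p _ Q hQ)]
  rfl

lemma applyVec_dIncl_formRatio (D : tangentSpace (XW f₀ L) p) {d : ℕ} (f Q : Form n d)
    (hQ : eval p.1.x.rep Q.1 ≠ 0) :
    applyVec (dIncl (XW_subset f₀ L) p D) (formRatio _ f Q) = applyVec D (formRatio _ f Q) :=
  applyVec_dIncl _ p D (formRatio_mem (Set.inclusion (XW_subset f₀ L) p) f Q hQ)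

lemma applyVec_dIncl_chartCoord (hk : p.1.x.rep k ≠ 0) (D : tangentSpace (XW f₀ L) p)
    (j : Fin (n + 1)) :
    applyVec (dIncl (XW_subset f₀ L) p D) (chartCoord _ k j) = applyVec D (chartCoord _ k j) :=
  applyVec_dIncl_formRatio D _ _ (by simpa using hk)

/-- The `A`-component of a vertical tangent vector satisfies the linear equation of `X_W`. -/
lemma sum_omitProd_mul_eq_zero (hk : p.1.x.rep k ≠ 0) {D : tangentSpace (XW f₀ L) p}
    (hD : ∀ j, applyVec D (chartCoord _ k j) = 0) {Q : Form n h} (hQ : eval p.1.x.rep Q.1 ≠ 0) :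
    ∑ l, eval p.1.x.rep (omitProd L l).1 * applyVec D (affineCoord _ l) = 0 := by
  -- In `A × W`, a vector that kills the `y_j` kills every function of `x`, in particular all `f /
  -- Q`; so only the terms in `D(a_l)` survive in `applyVec_equation`.
  have hx : dIncl (XW_subset f₀ L) p D ∈ relTangentSpace AffProj.x (prodAW f₀ L)
      (Set.inclusion (XW_subset f₀ L) p) :=
    (mem_relTangentSpace_x (p := Set.inclusion (XW_subset f₀ L) p) hk).2 fun j => by
      rw [applyVec_dIncl_chartCoord hk, hD]
  have hf (f : Form n h) : applyVec D (formRatio _ f Q) = 0 := by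
    rw [← applyVec_dIncl_formRatio D f Q hQ, applyVec_formRatio_of_mem hx f Q hQ]
  have := applyVec_equation D Q hQ
  simp only [hf, mul_zero, zero_add, div_mul_eq_mul_div] at this
  rwa [← Finset.sum_div, div_eq_zero_iff, or_iff_left hQ] at this

/-- Tangent vectors of `X_W` have arbitrary coordinates apart from `a_i`, where `M_i ≠ 0`. -/
theorem exists_tangent_XW (hk : p.1.x.rep k ≠ 0) {i : Fin (h + 1)}
    (hi : eval p.1.x.rep (omitProd L i).1 ≠ 0) (α : Fin (h + 1) → ℂ) {η : Fin (n + 1) → ℂ}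
    (hη : η k = 0) :
    ∃ D : tangentSpace (XW f₀ L) p, (∀ l, l ≠ i → applyVec D (affineCoord _ l) = α l) ∧
      ∀ j, applyVec D (chartCoord _ k j) = η j := by
  let w : ℂ → Fin (n + 1) → ℂ := fun t => p.1.x.rep + t • p.1.x.rep k • η
  -- `F` is affine in `a_i` with slope `M_i`, so lowering `a_i` by `F / M_i` moves the line `(a +
  -- tα, w(t))` onto `F = 0`.
  let b : ℂ → ℂ := fun t => eval (w t) (member f₀ L (p.1.a + t • α)).1 / eval (w t) (omitProd L i).1
  have hw0 : w 0 = p.1.x.rep := by simp [w]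
  have hw : DifferentiableAt ℂ w 0 := by fun_prop
  have hb : DifferentiableAt ℂ b 0 := by
    refine DifferentiableAt.div ?_ (differentiableAt_eval _ hw) (by rwa [hw0])
    simp only [eval_member]
    refine (differentiableAt_eval _ hw).fun_add (.fun_sum fun l _ => .mul ?_ (differentiableAt_eval _ hw))
    simp only [Pi.add_apply, Pi.smul_apply]
    fun_prop
  have hb0 : b 0 = 0 := by
    have hp : eval p.1.x.rep (member f₀ L p.1.a).1 = 0 := p.2.2
    simp [b, hw0, hp]
  have ha : HasDerivAt (fun t => p.1.a + t • α - b t • Pi.single i 1) (α - deriv b 0 • Pi.single i 1) 0 := by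
    have h1 := ((hasDerivAt_id (0 : ℂ)).smul_const α).const_add p.1.a
    simpa using h1.fun_sub (hb.hasDerivAt.smul_const (Pi.single i (1 : ℂ)))
  have ha0 : p.1.a + (0 : ℂ) • α - b 0 • Pi.single i 1 = p.1.a := by simp [hb0]
  have hS : ∀ᶠ t in 𝓝 0, projPoint (p.1.a + t • α - b t • Pi.single i 1) (w t) ∈ XW f₀ L := by
    have h1 : ∀ᶠ t : ℂ in 𝓝 0, p.1.a + t • α - b t • Pi.single i 1 ∈ parA f₀ L :=
      ha.continuousAt.eventually_mem ((isOpen_parA f₀ L).mem_nhds (by rw [ha0]; exact p.2.1.1))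
    have h2 : ∀ᶠ t in 𝓝 0, eval (w t) (omitProd L i).1 ≠ 0 :=
      (differentiableAt_eval _ hw).continuousAt.eventually_ne (by rwa [hw0])
    filter_upwards [h1, h2, eventually_mem_openW hw.continuousAt p.2.1.2 hw0,
      eventually_ne_zero_of_rep (p := p) hw.continuousAt hw0] with t ht ht2 ht3 ht4
    refine ⟨⟨ht, ht3⟩, (eval_rep_projPoint_eq_zero_iff _ _ ht4).2 ?_⟩
    change eval (w t) (member f₀ L (p.1.a + t • α - b t • Pi.single i 1)).1 = 0
    have : ∑ l, (b t • (Pi.single i 1 : Fin (h + 1) → ℂ)) l * eval (w t) (omitProd L l).1 =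
        eval (w t) (member f₀ L (p.1.a + t • α)).1 := by
      rw [Finset.sum_eq_single i (fun l _ hl => by simp [hl]) (by simp)]
      simp [b, ht2]
    rw [eval_member] at this ⊢
    simp only [Pi.sub_apply, sub_mul, Finset.sum_sub_distrib]
    rw [this]
    ring
  obtain ⟨D, hDa, hDx, -⟩ := exists_tangent_of_line hk ha ha0 hη hS
  refine ⟨D, fun l hl => ?_, hDx⟩
  simp [hDa, hl]

/-- Vertical tangent vectors of `X_W`. -/
theorem exists_vertical_tangent_XW (hk : p.1.x.rep k ≠ 0) {i : Fin (h + 1)}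
    (hi : eval p.1.x.rep (omitProd L i).1 ≠ 0) {α : Fin (h + 1) → ℂ}
    (hα : ∑ l, eval p.1.x.rep (omitProd L l).1 * α l = 0) :
    ∃ D : tangentSpace (XW f₀ L) p, (∀ l, applyVec D (affineCoord _ l) = α l) ∧
      ∀ j, applyVec D (chartCoord _ k j) = 0 := by
  obtain ⟨D, hDa, hDx⟩ := exists_tangent_XW (p := p) hk hi α (η := 0) rfl
  refine ⟨D, fun l => ?_, hDx⟩
  -- The `i`-th coordinate, left open by `exists_tangent_XW`, is forced: the components of `D` and
  -- `α` satisfy the same linear equation, agree off `i`, and `M_i ≠ 0`.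
  have h1 := sum_omitProd_mul_eq_zero hk hDx hi
  rw [← Finset.add_sum_erase _ _ (Finset.mem_univ i)] at h1 hα
  rw [Finset.sum_congr rfl fun l hl => by rw [hDa l (Finset.ne_of_mem_erase hl)]] at h1
  by_cases hl : l = i
  · subst hl
    exact mul_left_cancel₀ hi (by linear_combination h1 - hα)
  · exact hDa l hl

end X

/-! ### The linear algebra of the `u_i` -/

/-- If some `L_i` vanishes at `x`, it is the only one, and `M_i` omits it; otherwise every `M_i` is
nonzero. -/
lemma exists_omitProd_ne {x : ℙ ℂ (Fin (n + 1) → ℂ)} {L : Fin (h + 1) → Form n 1}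
    (hx : ∀ i j, i ≠ j → eval x.rep (L i).1 ≠ 0 ∨ eval x.rep (L j).1 ≠ 0) :
    ∃ i, eval x.rep (omitProd L i).1 ≠ 0 := by
  by_cases hall : ∀ i, eval x.rep (L i).1 ≠ 0
  · exact ⟨0, by rw [eval_omitProd]; exact Finset.prod_ne_zero_iff.2 fun j _ => hall j⟩
  · push Not at hall
    obtain ⟨i, hi⟩ := hall
    refine ⟨i, ?_⟩
    rw [eval_omitProd]
    exact Finset.prod_ne_zero_iff.2 fun j hj =>
      (hx j i (Finset.ne_of_mem_erase hj)).resolve_right (not_not.2 hi)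

lemma eval_ne_of_mem_openW {x : ℙ ℂ (Fin (n + 1) → ℂ)} {L : Fin (h + 1) → Form n 1}
    (hx : x ∈ openW L) (i j : Fin (h + 1)) (hij : i ≠ j) :
    eval x.rep (L i).1 ≠ 0 ∨ eval x.rep (L j).1 ≠ 0 := by
  rcases lt_or_gt_of_ne hij with hij | hij
  · exact not_and_or.1 (hx i j hij)
  · exact (not_and_or.1 (hx j i hij)).symm

/-- The vector `c_0 e_0 - c_i e_i` of coefficients of `u_i`. -/
def uCoeff (c : Fin (h + 1) → ℂ) (i : Fin h) : Fin (h + 1) → ℂ :=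
  c 0 • Pi.single 0 1 - c i.succ • Pi.single i.succ 1

/-- A relation `g` gives `g_i c_{i+1} = 0` for each `i` and `(∑ g_i) c_0 = 0`. If `g_i ≠ 0`, then
`c_{i+1} = 0`, so all other `c_j` are nonzero and all other `g_j` vanish; the last equation becomes
`g_i c_0 = 0`, a contradiction. -/
lemma linearIndependent_uCoeff {c : Fin (h + 1) → ℂ} (hc : ∀ i j, i ≠ j → c i ≠ 0 ∨ c j ≠ 0) :
    LinearIndependent ℂ (uCoeff c) := by
  rw [Fintype.linearIndependent_iff]
  intro g hg
  have h1 (i : Fin h) : g i * c i.succ = 0 := by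
    have := congrFun hg i.succ
    simp only [Finset.sum_apply, Pi.smul_apply, uCoeff, Pi.sub_apply, smul_eq_mul, Pi.zero_apply,
      Pi.single_apply, Fin.succ_ne_zero, if_false, mul_zero, zero_sub, Fin.succ_inj] at this
    simpa using this
  have h0 : (∑ i, g i) * c 0 = 0 := by
    have := congrFun hg 0
    simp only [Finset.sum_apply, Pi.smul_apply, uCoeff, Pi.sub_apply, smul_eq_mul, Pi.zero_apply,
      Pi.single_apply, (Fin.succ_ne_zero _).symm, if_false, if_true, mul_zero, sub_zero,
      mul_one] at this
    rwa [← Finset.sum_mul] at this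
  intro i
  by_contra hgi
  have hci : c i.succ = 0 := (mul_eq_zero.1 (h1 i)).resolve_left hgi
  have hg0 (j : Fin h) (hj : j ≠ i) : g j = 0 :=
    (mul_eq_zero.1 (h1 j)).resolve_right
      ((hc j.succ i.succ (by simpa using hj)).resolve_right (not_not.2 hci))
  rw [Finset.sum_eq_single i (fun j _ hj => hg0 j hj) (by simp)] at h0
  exact mul_ne_zero hgi ((hc 0 i.succ (Fin.succ_ne_zero i).symm).resolve_right (not_not.2 hci)) h0

/-- Both terms equal the full product `∏ c_j`, so they cancel. With `c_j` the values of the `L_j`,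
this says that `u_i` is tangent to `X_W`. -/
lemma sum_mul_uCoeff (c : Fin (h + 1) → ℂ) (i : Fin h) :
    ∑ l, (∏ j ∈ Finset.univ.erase l, c j) * uCoeff c i l = 0 := by
  simp only [uCoeff, Pi.sub_apply, Pi.smul_apply, smul_eq_mul, mul_sub, Finset.sum_sub_distrib,
    Pi.single_apply, mul_ite, mul_one, mul_zero, Finset.sum_ite_eq', Finset.mem_univ, if_true]
  rw [Finset.prod_erase_mul _ _ (Finset.mem_univ _), Finset.prod_erase_mul _ _ (Finset.mem_univ _),
    sub_self]

/-- The linear form with coefficients `∏_{j ≠ l} c_j` is nonzero, so its kernel has dimension `h`,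
and the `h` independent vectors `uCoeff c i` in it span it. -/
lemma mem_span_uCoeff {c : Fin (h + 1) → ℂ} (hc : ∀ i j, i ≠ j → c i ≠ 0 ∨ c j ≠ 0)
    {i : Fin (h + 1)} (hi : ∏ j ∈ Finset.univ.erase i, c j ≠ 0) {α : Fin (h + 1) → ℂ}
    (hα : ∑ l, (∏ j ∈ Finset.univ.erase l, c j) * α l = 0) :
    α ∈ Submodule.span ℂ (Set.range (uCoeff c)) := by
  let φ : (Fin (h + 1) → ℂ) →ₗ[ℂ] ℂ := ∑ l, (∏ j ∈ Finset.univ.erase l, c j) • LinearMap.proj l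
  have hφ (β) : φ β = ∑ l, (∏ j ∈ Finset.univ.erase l, c j) * β l := by simp [φ]
  have hle : Submodule.span ℂ (Set.range (uCoeff c)) ≤ φ.ker := by
    rw [Submodule.span_le]
    rintro _ ⟨i, rfl⟩
    exact (hφ _).trans (sum_mul_uCoeff c i)
  have hsurj : Function.Surjective φ := by
    refine LinearMap.surjective fun h0 => hi ?_
    have := hφ (Pi.single i 1)
    rw [h0] at this
    simpa [Pi.single_apply] using this.symm
  have hker : Module.finrank ℂ φ.ker = h := by
    have := φ.finrank_range_add_finrank_ker
    rw [LinearMap.range_eq_top.2 hsurj] at this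
    simp at this
    omega
  have : Submodule.span ℂ (Set.range (uCoeff c)) = φ.ker := by
    refine Submodule.eq_of_le_of_finrank_eq hle ?_
    rw [hker, finrank_span_eq_card (linearIndependent_uCoeff hc), Fintype.card_fin]
  rw [this, LinearMap.mem_ker, hφ, hα]

end Family

/-! ### Twists -/

section Line

variable {n : ℕ} {x : ℙ ℂ (Fin (n + 1) → ℂ)}

/-- The representative of a point, as a vector of the corresponding line. -/
def repVec (x : ℙ ℂ (Fin (n + 1) → ℂ)) : x.submodule :=
  ⟨x.rep, by rw [Projectivization.submodule_eq]; exact Submodule.mem_span_singleton_self _⟩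

lemma lineFun_ext {k : ℕ} {s t : lineFun k x} (hst : s.1 (repVec x) = t.1 (repVec x)) : s = t := by
  ext w
  have hw : w.1 ∈ Submodule.span ℂ {x.rep} := by
    rw [← Projectivization.submodule_eq]
    exact w.2
  obtain ⟨c, hc⟩ := Submodule.mem_span_singleton.1 hw
  have : w = c • repVec x := Subtype.ext hc.symm
  rw [this, s.2, t.2, hst]

lemma lineFun_eq_smul {k : ℕ} {ζ : lineFun k x} (hζ : ζ.1 (repVec x) ≠ 0) (s : lineFun k x) :
    s = (s.1 (repVec x) / ζ.1 (repVec x)) • ζ := by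
  refine lineFun_ext ?_
  change _ = s.1 (repVec x) / ζ.1 (repVec x) * ζ.1 (repVec x)
  rw [div_mul_cancel₀ _ hζ]

lemma formAt_repVec {k : ℕ} (f : Form n k) : (formAt f x).1 (repVec x) = eval x.rep f.1 := rfl

/-- The trivialization of a twist by a generator of the fibre of `O(1)`. -/
def twistEquiv (V : Type*) [AddCommGroup V] [Module ℂ V] (ζ : lineFun 1 x)
    (hζ : ζ.1 (repVec x) ≠ 0) : V ≃ₗ[ℂ] V ⊗[ℂ] lineFun 1 x :=
  LinearEquiv.ofLinearMap ((TensorProduct.mk ℂ V (lineFun 1 x)).flip ζ)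
    (TensorProduct.lift (LinearMap.mk₂ ℂ
      (fun v s => (s.1 (repVec x) / ζ.1 (repVec x)) • v)
      (fun v v' s => smul_add _ _ _) (fun c v s => smul_comm _ _ _)
      (fun v s t => by simp [add_div, add_smul])
      (fun c v s => by simp [mul_div_assoc, mul_smul])))
    (by
      ext v s
      simp only [TensorProduct.AlgebraTensorModule.curry_apply, LinearMap.restrictScalars_self,
        TensorProduct.curry_apply, LinearMap.comp_apply, TensorProduct.lift.tmul,
        LinearMap.mk₂_apply, LinearMap.flip_apply, TensorProduct.mk_apply, LinearMap.id_apply]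
      rw [TensorProduct.smul_tmul, ← lineFun_eq_smul hζ s])
    (by
      ext v
      simp [div_self hζ])

/-- The fibre of `O(1)` is a line, so all tensors are pure; this reduces statements about twisted
bundles to untwisted ones. -/
lemma exists_eq_tmul {V : Type*} [AddCommGroup V] [Module ℂ V] {ζ : lineFun 1 x}
    (hζ : ζ.1 (repVec x) ≠ 0) (τ : V ⊗[ℂ] lineFun 1 x) : ∃ v : V, τ = v ⊗ₜ ζ := by
  obtain ⟨v, rfl⟩ := (twistEquiv V ζ hζ).surjective τ
  exact ⟨v, rfl⟩

lemma tmul_right_injective {V : Type*} [AddCommGroup V] [Module ℂ V] {ζ : lineFun 1 x}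
    (hζ : ζ.1 (repVec x) ≠ 0) {v v' : V} (h : v ⊗ₜ[ℂ] ζ = v' ⊗ₜ[ℂ] ζ) : v = v' :=
  (twistEquiv V ζ hζ).injective h

lemma varForm_repVec_ne {k : Fin (n + 1)} (hk : x.rep k ≠ 0) :
    (formAt (varForm k) x).1 (repVec x) ≠ 0 := by
  rw [formAt_repVec]
  simpa using hk

end Line

/-! ### Regular sections of twists -/

section Bundles

variable {m n : ℕ} {S : Set (AffProj m n)}

/-- The regular sections form a sheaf of modules over the regular functions. -/
structure RegBundle.HasRegularModule (E : RegBundle S) : Prop where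
  congr : ∀ {p : S} {s t : ∀ q, E.fibre q}, E.IsRegAt p s → (∀ᶠ q in 𝓝 p, s q = t q) →
    E.IsRegAt p t
  sum : ∀ {p : S} {r : ℕ} {g : Fin r → S → ℂ} {s : Fin r → ∀ q, E.fibre q},
    (∀ i, IsRegularAt S p (g i)) → (∀ i, E.IsRegAt p (s i)) →
      E.IsRegAt p fun q => ∑ i, g i q • s i q

lemma tangentBundle_hasRegularModule (S : Set (AffProj m n)) :
    (tangentBundle S).HasRegularModule where
  congr hs hst f hf := by
    refine (hs f hf).congr ?_
    filter_upwards [hst] with q hq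
    change applyVec _ f = applyVec _ f
    rw [hq]
  sum {p r g s} hg hs f hf := by
    have key (s : Fin r → ∀ q, tangentSpace S q) (q : S) :
        ∑ i, g i q * applyVec (s i q) f = applyVec (∑ i, g i q • s i q) f := by simp
    exact (IsRegularAt.sum _ fun i _ => (hg i).mul (hs i f hf)).congr
      (Eventually.of_forall (key s))

lemma RegBundle.HasRegularModule.sub {E : RegBundle S} (hE : E.HasRegularModule)
    (G : ∀ p, Submodule ℂ (E.fibre p)) : (E.sub G).HasRegularModule where
  congr hs hst := hE.congr hs (hst.mono fun q hq => congrArg Subtype.val hq)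
  sum {p r g s} hg hs := by
    have := hE.sum hg hs
    refine hE.congr this (Eventually.of_forall fun q => ?_)
    have key (s : Fin r → G q) : ∑ i, g i q • (s i).1 = (∑ i, g i q • s i : G q).1 := by simp
    exact key fun i => s i q

lemma isRegAt_formAt (f : Form n 1) (p : S) :
    (lineBundle 1 S).IsRegAt p fun q => formAt f q.1.x := by
  refine ⟨0, map C f.1, 1, ?_, isHomogeneous_one _ _, by simp [evp, ev], ?_⟩
  · exact ((mem_homogeneousSubmodule 1 f.1).1 f.2).map _
  · refine Eventually.of_forall fun q w => ?_
    have : (eval q.1.a).comp (C : ℂ →+* MvPolynomial (Fin m) ℂ) = RingHom.id ℂ := by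
      ext r; simp
    simp [ev, formAt, MvPolynomial.map_map, this]

/-- A section of `O(1)` is locally `P / Q` with `P` of degree one more than `Q`; its coefficient
with respect to `x_k` is `P / (Q x_k)`. -/
lemma isRegularAt_of_isRegAt_lineBundle {p : S} {t : ∀ q, (lineBundle 1 S).fibre q}
    (ht : (lineBundle 1 S).IsRegAt p t) {k : Fin (n + 1)} (hk : p.1.x.rep k ≠ 0) :
    IsRegularAt S p fun q => (t q).1 (repVec q.1.x) / q.1.x.rep k := by
  obtain ⟨d, P, Q, hP, hQ, h0, h⟩ := ht
  have hX (q : AffProj m n) : evp (X k : BiPoly m n) q = q.x.rep k := by simp [evp, ev]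
  refine ⟨d + 1, P, Q * X k, hP, hQ.mul (isHomogeneous_X _ _), ?_, ?_⟩
  · rw [evp_mul, hX]
    exact mul_ne_zero h0 hk
  · filter_upwards [h, eventually_evp_ne p hQ h0] with q h1 h2
    rw [evp_mul, hX, ← div_div]
    congr 1
    rw [eq_div_iff h2]
    exact h1 (repVec q.1.x)

/-- In a chart, the regular sections of a twist are the `s ⊗ x_k` with `s` regular. -/
theorem twist_isRegAt_iff {E : RegBundle S} (hE : E.HasRegularModule) {p : S} {k : Fin (n + 1)}
    (hk : p.1.x.rep k ≠ 0) (r : ∀ q, E.fibre q ⊗[ℂ] lineFun 1 q.1.x) :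
    E.twist.IsRegAt p r ↔ ∃ s : ∀ q, E.fibre q, E.IsRegAt p s ∧
      ∀ᶠ q in 𝓝 p, r q = s q ⊗ₜ formAt (varForm k) q.1.x := by
  constructor
  · rintro ⟨N, s, t, hs, ht, hr⟩
    refine ⟨fun q => ∑ i, ((t i q).1 (repVec q.1.x) / q.1.x.rep k) • s i q,
      hE.sum (fun i => isRegularAt_of_isRegAt_lineBundle (ht i) hk) hs, ?_⟩
    filter_upwards [hr, eventually_rep_ne p hk] with q h1 h2
    rw [h1, TensorProduct.sum_tmul]
    refine Finset.sum_congr rfl fun i _ => ?_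
    have := lineFun_eq_smul (varForm_repVec_ne h2) (t i q)
    rw [formAt_repVec, eval_varForm] at this
    conv_lhs => rw [this]
    rw [TensorProduct.smul_tmul]
    rfl
  · rintro ⟨s, hs, hr⟩
    refine ⟨1, fun _ => s, fun _ q => formAt (varForm k) q.1.x, fun _ => hs,
      fun _ => isRegAt_formAt _ p, ?_⟩
    filter_upwards [hr] with q hq
    rw [hq, Finset.univ_unique, Finset.sum_singleton]
    rfl

end Bundles

/-! ### The bundle `T_{W/A}(1)` -/

section Family

variable {n h : ℕ} {f₀ : Form n h} {L : Fin (h + 1) → Form n 1}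

lemma single_succAbove_self (k : Fin (n + 1)) (j : Fin n) :
    (Pi.single (k.succAbove j) 1 : Fin (n + 1) → ℂ) k = 0 := by
  simp [(Fin.succAbove_ne k j).symm]

open Classical in
variable (f₀ L) in
/-- The vector field `∂/∂y_j` along `W`, in the chart where `x_k ≠ 0`. -/
def chartField (k : Fin (n + 1)) (j : Fin n) (q : prodAW f₀ L) :
    relTangentSpace AffProj.a (prodAW f₀ L) q :=
  if hk : q.1.x.rep k ≠ 0 then
    ⟨(exists_tangent_prodAW hk 0 (single_succAbove_self k j)).choose,
      (exists_tangent_prodAW hk 0 (single_succAbove_self k j)).choose_spec.2.2.1 rfl⟩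
  else 0

lemma chartField_chartCoord {q : prodAW f₀ L} {k : Fin (n + 1)} (hk : q.1.x.rep k ≠ 0) (j : Fin n)
    (l : Fin (n + 1)) : applyVec (chartField f₀ L k j q).1 (chartCoord _ k l) =
      (Pi.single (k.succAbove j) 1 : Fin (n + 1) → ℂ) l := by
  rw [chartField, dif_pos hk]
  exact (exists_tangent_prodAW hk 0 (single_succAbove_self k j)).choose_spec.2.1 l

lemma chartField_affineCoord (q : prodAW f₀ L) (k : Fin (n + 1)) (j : Fin n)
    (i : Fin (h + 1)) : applyVec (chartField f₀ L k j q).1 (affineCoord _ i) = 0 :=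
  mem_relTangentSpace_a.1 (chartField f₀ L k j q).2 i

/-- The vectors are chosen point by point, yet the field is regular, because its coordinates are
constant near `q`. -/
lemma isRegAt_chartField {q : prodAW f₀ L} {k : Fin (n + 1)} (hk : q.1.x.rep k ≠ 0) (j : Fin n) :
    (tangentBundle (prodAW f₀ L)).IsRegAt q fun q => (chartField f₀ L k j q).1 := by
  refine isRegAt_of_coords hk (fun i => ?_) fun l => ?_
  · simp only [chartField_affineCoord]
    exact isRegularAt_const q 0
  · refine (isRegularAt_const q ((Pi.single (k.succAbove j) 1 : Fin (n + 1) → ℂ) l)).congr ?_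
    filter_upwards [eventually_rep_ne q hk] with q' hq'
    rw [chartField_chartCoord hq']

/-- The `a_i` are killed by definition and `y_k` is locally constant, so the `n` remaining
coordinates determine the vector. -/
lemma relTangent_ext {q : prodAW f₀ L} {k : Fin (n + 1)} (hk : q.1.x.rep k ≠ 0)
    {D E : relTangentSpace AffProj.a (prodAW f₀ L) q}
    (hDE : ∀ j : Fin n, applyVec D.1 (chartCoord _ k (k.succAbove j)) =
      applyVec E.1 (chartCoord _ k (k.succAbove j))) : D = E := by
  refine Subtype.ext (tangent_ext hk (fun i => ?_) fun l => ?_)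
  · rw [mem_relTangentSpace_a.1 D.2, mem_relTangentSpace_a.1 E.2]
  · by_cases hl : l = k
    · rw [hl, chartCoord_self hk, chartCoord_self hk]
    · obtain ⟨j, rfl⟩ := Fin.exists_succAbove_eq hl
      exact hDE j

lemma applyVec_sum_chartField {q : prodAW f₀ L} {k : Fin (n + 1)} (hk : q.1.x.rep k ≠ 0)
    (c : Fin n → ℂ) (j : Fin n) : applyVec (∑ j, c j • chartField f₀ L k j q).1
      (chartCoord _ k (k.succAbove j)) = c j := by
  rw [← Submodule.subtype_apply, map_sum, applyVec_sum]
  simp [chartField_chartCoord hk, Pi.single_apply]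

lemma relTangent_eq_sum {q : prodAW f₀ L} {k : Fin (n + 1)} (hk : q.1.x.rep k ≠ 0)
    (D : relTangentSpace AffProj.a (prodAW f₀ L) q) :
    D = ∑ j, applyVec D.1 (chartCoord _ k (k.succAbove j)) • chartField f₀ L k j q :=
  relTangent_ext hk fun j => (applyVec_sum_chartField hk
    (fun j => applyVec D.1 (chartCoord _ k (k.succAbove j))) j).symm

variable (f₀ L) in
/-- The frame `∂/∂y_j ⊗ x_k` of `T_{W/A}(1)` on `X_W`. -/
def chartFrame (k : Fin (n + 1)) (j : Fin n) (q : XW f₀ L) : (TWA1 f₀ L).fibre q :=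
  (chartField f₀ L k j (Set.inclusion (XW_subset f₀ L) q) ⊗ₜ[ℂ] formAt (varForm k) q.1.x :
    relTangentSpace AffProj.a (prodAW f₀ L) (Set.inclusion (XW_subset f₀ L) q) ⊗[ℂ]
      lineFun 1 q.1.x)

lemma tmul_eq_sum_chartFrame {q : XW f₀ L} {k : Fin (n + 1)} (hk : q.1.x.rep k ≠ 0)
    (D : relTangentSpace AffProj.a (prodAW f₀ L) (Set.inclusion (XW_subset f₀ L) q)) :
    (D ⊗ₜ[ℂ] formAt (varForm k) q.1.x : relTangentSpace AffProj.a (prodAW f₀ L)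
      (Set.inclusion (XW_subset f₀ L) q) ⊗[ℂ] lineFun 1 q.1.x) =
    ∑ j, applyVec D.1 (chartCoord _ k (k.succAbove j)) • chartFrame f₀ L k j q := by
  conv_lhs => rw [relTangent_eq_sum hk D, TensorProduct.sum_tmul]
  exact Finset.sum_congr rfl fun j _ => TensorProduct.smul_tmul' _ _ _

/-- A regular section on `A × W` is locally `s ⊗ x_k`, and its coefficients `s(y_j)` in the frame
are regular and restrict to `X_W`. Conversely, the frame itself is restricted from regular sections
on `A × W`. -/
theorem TWA1_isRegAt_iff {p : XW f₀ L} {k : Fin (n + 1)} (hk : p.1.x.rep k ≠ 0)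
    (r : ∀ q, (TWA1 f₀ L).fibre q) :
    (TWA1 f₀ L).IsRegAt p r ↔ ∃ g : Fin n → XW f₀ L → ℂ, (∀ j, IsRegularAt _ p (g j)) ∧
      ∀ᶠ q in 𝓝 p, r q = ∑ j, g j q • chartFrame f₀ L k j q := by
  have hmod := (tangentBundle_hasRegularModule (prodAW f₀ L)).sub
    (relTangentSpace AffProj.a (prodAW f₀ L))
  have hk' : (Set.inclusion (XW_subset f₀ L) p).1.x.rep k ≠ 0 := hk
  have hcont := (continuous_inclusion (XW_subset f₀ L)).continuousAt (x := p)
  constructor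
  · rintro ⟨N, g, s, hg, hs, hr⟩
    have hs' (i : Fin N) := (twist_isRegAt_iff hmod hk' (s i)).1 (hs i)
    choose s' hs' hss' using hs'
    refine ⟨fun j q => ∑ i, g i q * applyVec (s' i (Set.inclusion (XW_subset f₀ L) q)).1
      (chartCoord _ k (k.succAbove j)), fun j => .sum _ fun i _ => (hg i).mul ?_, ?_⟩
    · exact IsRegularAt.restrict (XW_subset f₀ L)
        (hs' i _ (chartCoord_mem (Set.inclusion (XW_subset f₀ L) p) hk' _))
    · filter_upwards [hr, eventually_rep_ne p hk,
        hcont.eventually (eventually_all.2 fun i => hss' i)] with q h1 h2 h3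
      rw [h1]
      simp only [Finset.sum_smul]
      rw [Finset.sum_comm]
      refine Finset.sum_congr rfl fun i _ => ?_
      rw [h3 i]
      refine (congrArg (g i q • ·) (tmul_eq_sum_chartFrame h2 _)).trans ?_
      refine Finset.smul_sum.trans (Finset.sum_congr rfl fun j _ => ?_)
      exact smul_smul _ _ _
  · rintro ⟨g, hg, hr⟩
    refine ⟨n, g, fun j q => (chartField f₀ L k j q ⊗ₜ[ℂ] formAt (varForm k) q.1.x :
      relTangentSpace AffProj.a (prodAW f₀ L) q ⊗[ℂ] lineFun 1 q.1.x), hg, fun j => ?_, hr⟩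
    exact (twist_isRegAt_iff hmod hk' _).2
      ⟨chartField f₀ L k j, isRegAt_chartField hk' j, Eventually.of_forall fun _ => rfl⟩

/-- The derivatives of the `y_j`, `j ≠ k`, identify `T_{W/A}` with `ℂ^n` and send the fields
`∂/∂y_j` to the standard basis; tensoring with the generator `x_k` preserves this. -/
lemma exists_basis_chartFrame {q : XW f₀ L} {k : Fin (n + 1)} (hk : q.1.x.rep k ≠ 0) :
    ∃ b : Module.Basis (Fin n) ℂ ((TWA1 f₀ L).fibre q), ∀ j, b j = chartFrame f₀ L k j q := by
  let q' := Set.inclusion (XW_subset f₀ L) q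
  have hk' : q'.1.x.rep k ≠ 0 := hk
  let φ : relTangentSpace AffProj.a (prodAW f₀ L) q' →ₗ[ℂ] (Fin n → ℂ) :=
    LinearMap.pi fun j => applyVecₗ q' (chartCoord _ k (k.succAbove j)) ∘ₗ Submodule.subtype _
  have hφ (D) (j) : φ D j = applyVec D.1 (chartCoord _ k (k.succAbove j)) := rfl
  have hinj : Function.Injective φ := fun D E hDE => relTangent_ext hk' fun j => congrFun hDE j
  have hfield (j : Fin n) : φ (chartField f₀ L k j q') = Pi.single j 1 := by
    ext l
    rw [hφ, chartField_chartCoord hk']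
    simp [Pi.single_apply]
  have hsurj : Function.Surjective φ := by
    intro v
    refine ⟨∑ j, v j • chartField f₀ L k j q', ?_⟩
    simp only [map_sum, map_smul, hfield]
    exact (pi_eq_sum_univ' v).symm
  let e := LinearEquiv.ofBijective φ ⟨hinj, hsurj⟩
  let b := (Module.Basis.ofEquivFun e).map
    (twistEquiv (relTangentSpace AffProj.a (prodAW f₀ L) q') _ (varForm_repVec_ne hk))
  refine ⟨b, fun j => ?_⟩
  have : e.symm (Pi.single j 1) = chartField f₀ L k j q' := by
    rw [LinearEquiv.symm_apply_eq]
    exact (hfield j).symm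
  have hb : b j = twistEquiv _ _ (varForm_repVec_ne hk) (e.symm (Pi.single j 1)) := by
    simp [b]
  rw [this] at hb
  exact hb

theorem TWA1_isLocallyFree : (TWA1 f₀ L).IsLocallyFree n := by
  intro p
  obtain ⟨k, hk⟩ := exists_rep_ne p.1.x
  refine ⟨chartFrame f₀ L k, ?_⟩
  filter_upwards [eventually_rep_ne p hk] with q hq
  exact ⟨exists_basis_chartFrame hq, TWA1_isRegAt_iff hq⟩

end Family

/-! ### The isomorphism `T X_W(1) / G(1) ≅ T_{W/A}(1)` -/

section Family

variable {n h : ℕ} {f₀ : Form n h} {L : Fin (h + 1) → Form n 1}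

variable (f₀ L) in
/-- The map `T X_W → T_{W/A}`, `α + v ↦ -v`. -/
def negProj (p : XW f₀ L) : tangentSpace (XW f₀ L) p →ₗ[ℂ]
    relTangentSpace AffProj.a (prodAW f₀ L) (Set.inclusion (XW_subset f₀ L) p) :=
  (-1 : ℂ) • (Submodule.projectionOnto _ _
    (isCompl_relTangentSpace (p := Set.inclusion (XW_subset f₀ L) p)) ∘ₗ dIncl (XW_subset f₀ L) p)

/-- For `D = α + v` the sum is `α`. -/
lemma dIncl_add_negProj_mem (p : XW f₀ L) (D : tangentSpace (XW f₀ L) p) :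
    dIncl (XW_subset f₀ L) p D + (negProj f₀ L p D).1 ∈
      relTangentSpace AffProj.x (prodAW f₀ L) (Set.inclusion (XW_subset f₀ L) p) := by
  have hc := isCompl_relTangentSpace (p := Set.inclusion (XW_subset f₀ L) p)
  rw [← Submodule.projectionOnto_apply_eq_zero_iff hc, map_add,
    Submodule.projectionOnto_apply_left hc, negProj, LinearMap.smul_apply]
  have key {V : Type} [AddCommGroup V] [Module ℂ V] (v : V) : v + (-1 : ℂ) • v = 0 := by
    rw [neg_one_smul, add_neg_cancel]
  exact key (V := relTangentSpace AffProj.a (prodAW f₀ L) (Set.inclusion (XW_subset f₀ L) p)) _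

/-- `f / Q` depends on `x` alone, so the component along `A` does not contribute. -/
lemma negProj_formRatio {p : XW f₀ L} (D : tangentSpace (XW f₀ L) p) {d : ℕ} (f Q : Form n d)
    (hQ : eval p.1.x.rep Q.1 ≠ 0) :
    applyVec (negProj f₀ L p D).1 (formRatio _ f Q) = -applyVec D (formRatio _ f Q) := by
  have h1 := applyVec_formRatio_of_mem (dIncl_add_negProj_mem p D) f Q hQ
  rw [applyVec_add, applyVec_dIncl_formRatio D f Q hQ] at h1
  linear_combination h1

lemma negProj_chartCoord {p : XW f₀ L} {k : Fin (n + 1)} (hk : p.1.x.rep k ≠ 0)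
    (D : tangentSpace (XW f₀ L) p) (j : Fin (n + 1)) :
    applyVec (negProj f₀ L p D).1 (chartCoord _ k j) = -applyVec D (chartCoord _ k j) :=
  negProj_formRatio D _ _ (by simpa using hk)

lemma negProj_eq_zero_iff {p : XW f₀ L} {k : Fin (n + 1)} (hk : p.1.x.rep k ≠ 0)
    {D : tangentSpace (XW f₀ L) p} :
    negProj f₀ L p D = 0 ↔ ∀ j, applyVec D (chartCoord _ k j) = 0 := by
  refine ⟨fun hD j => ?_, fun hD => relTangent_ext hk fun j => ?_⟩
  · have := negProj_chartCoord hk D j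
    rw [hD] at this
    simpa using this
  · rw [negProj_chartCoord hk, hD]
    simp

lemma exists_omitProd_ne_of_mem (p : XW f₀ L) : ∃ i, eval p.1.x.rep (omitProd L i).1 ≠ 0 :=
  exists_omitProd_ne (eval_ne_of_mem_openW p.2.1.2)

open Classical in
variable (f₀ L) in
/-- The vector field on `X_W` that lifts `∂/∂y_j` and has no components along the `a_l`, `l ≠ i`. -/
def liftField (k : Fin (n + 1)) (i : Fin (h + 1)) (j : Fin n) (q : XW f₀ L) :
    tangentSpace (XW f₀ L) q :=
  if hk : q.1.x.rep k ≠ 0 ∧ eval q.1.x.rep (omitProd L i).1 ≠ 0 then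
    (exists_tangent_XW hk.1 hk.2 0 (single_succAbove_self k j)).choose
  else 0

section Lift

variable {p : XW f₀ L} {k : Fin (n + 1)} {i : Fin (h + 1)}

lemma liftField_affineCoord (hk : p.1.x.rep k ≠ 0)
    (hi : eval p.1.x.rep (omitProd L i).1 ≠ 0) (j : Fin n) {l : Fin (h + 1)} (hl : l ≠ i) :
    applyVec (liftField f₀ L k i j p) (affineCoord _ l) = 0 := by
  rw [liftField, dif_pos ⟨hk, hi⟩]
  exact (exists_tangent_XW hk hi 0 (single_succAbove_self k j)).choose_spec.1 l hl

lemma liftField_chartCoord (hk : p.1.x.rep k ≠ 0)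
    (hi : eval p.1.x.rep (omitProd L i).1 ≠ 0) (j : Fin n) (l : Fin (n + 1)) : applyVec (liftField f₀ L k i j p)
    (chartCoord _ k l) = (Pi.single (k.succAbove j) 1 : Fin (n + 1) → ℂ) l := by
  rw [liftField, dif_pos ⟨hk, hi⟩]
  exact (exists_tangent_XW hk hi 0 (single_succAbove_self k j)).choose_spec.2 l

lemma negProj_liftField (hk : p.1.x.rep k ≠ 0)
    (hi : eval p.1.x.rep (omitProd L i).1 ≠ 0) (j : Fin n) : negProj f₀ L p (liftField f₀ L k i j p) =
    -chartField f₀ L k j (Set.inclusion (XW_subset f₀ L) p) := by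
  refine relTangent_ext hk fun l => ?_
  rw [negProj_chartCoord hk, liftField_chartCoord hk hi, Submodule.coe_neg, applyVec_neg]
  exact congrArg _ (chartField_chartCoord (q := Set.inclusion (XW_subset f₀ L) p) hk j _).symm

lemma liftField_formRatio (hk : p.1.x.rep k ≠ 0)
    (hi : eval p.1.x.rep (omitProd L i).1 ≠ 0) (j : Fin n) {d : ℕ} (f Q : Form n d) (hQ : eval p.1.x.rep Q.1 ≠ 0) :
    applyVec (liftField f₀ L k i j p) (formRatio _ f Q) =
      applyVec (chartField f₀ L k j (Set.inclusion (XW_subset f₀ L) p)).1 (formRatio _ f Q) := by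
  have := negProj_formRatio (liftField f₀ L k i j p) f Q hQ
  rw [negProj_liftField hk hi, Submodule.coe_neg, applyVec_neg] at this
  exact (neg_injective this).symm

/-- Solve `applyVec_equation` with `Q = M_i`: the unknown component has coefficient `M_i / M_i = 1`
and the other `a_l`-components vanish. The right-hand side involves only a regular field on `A × W`,
which is what makes the lift regular. -/
lemma liftField_affineCoord_self (hk : p.1.x.rep k ≠ 0)
    (hi : eval p.1.x.rep (omitProd L i).1 ≠ 0) (j : Fin n) : applyVec (liftField f₀ L k i j p) (affineCoord _ i) =
    -(applyVec (chartField f₀ L k j (Set.inclusion (XW_subset f₀ L) p)).1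
      (formRatio _ f₀ (omitProd L i)) + ∑ l, p.1.a l *
        applyVec (chartField f₀ L k j (Set.inclusion (XW_subset f₀ L) p)).1
          (formRatio _ (omitProd L l) (omitProd L i))) := by
  have := applyVec_equation (liftField f₀ L k i j p) (omitProd L i) hi
  simp only [liftField_formRatio hk hi j _ _ hi] at this
  rw [Finset.sum_add_distrib, Finset.sum_eq_single (f := fun l => _ / _ * _) i
    (fun l _ hl => by rw [liftField_affineCoord hk hi j hl, mul_zero]) (by simp), div_self hi] at this
  linear_combination this

lemma isRegAt_liftField (hk : p.1.x.rep k ≠ 0)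
    (hi : eval p.1.x.rep (omitProd L i).1 ≠ 0) (j : Fin n) :
    (tangentBundle (XW f₀ L)).IsRegAt p fun q => liftField f₀ L k i j q := by
  refine isRegAt_of_coords hk (fun l => ?_) fun l => ?_
  · by_cases hl : l = i
    · subst hl
      have hc (f : Form n h) : IsRegularAt (XW f₀ L) p fun q =>
          applyVec (chartField f₀ L k j (Set.inclusion (XW_subset f₀ L) q)).1
            (formRatio _ f (omitProd L l)) :=
        IsRegularAt.restrict (XW_subset f₀ L)
          (isRegularAt_applyVec (isRegAt_chartField (q := Set.inclusion (XW_subset f₀ L) p) hk j)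
            (formRatio_mem (Set.inclusion (XW_subset f₀ L) p) f _ hi))
      have ha (l : Fin (h + 1)) : IsRegularAt (XW f₀ L) p fun q => q.1.a l := affineCoord_mem p l
      refine ((hc f₀).add (.sum Finset.univ fun l _ => (ha l).mul (hc (omitProd L l)))).neg.congr ?_
      filter_upwards [eventually_rep_ne p hk, eventually_eval_ne p _ hi] with q h1 h2
      exact (liftField_affineCoord_self h1 h2 j).symm
    · refine (isRegularAt_const p 0).congr ?_
      filter_upwards [eventually_rep_ne p hk, eventually_eval_ne p _ hi] with q h1 h2
      rw [liftField_affineCoord h1 h2 j hl]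
  · refine (isRegularAt_const p ((Pi.single (k.succAbove j) 1 : Fin (n + 1) → ℂ) l)).congr ?_
    filter_upwards [eventually_rep_ne p hk, eventually_eval_ne p _ hi] with q h1 h2
    rw [liftField_chartCoord h1 h2]

lemma negProj_sum_liftField (hk : p.1.x.rep k ≠ 0) (hi : eval p.1.x.rep (omitProd L i).1 ≠ 0)
    (c : Fin n → ℂ) : negProj f₀ L p (∑ j, (-c j) • liftField f₀ L k i j p) =
      ∑ j, c j • chartField f₀ L k j (Set.inclusion (XW_subset f₀ L) p) := by
  refine relTangent_ext hk fun l => ?_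
  rw [negProj_chartCoord hk, applyVec_sum]
  refine Eq.trans ?_ (applyVec_sum_chartField (q := Set.inclusion (XW_subset f₀ L) p) hk c l).symm
  simp [liftField_chartCoord hk hi, Pi.single_apply]

end Lift

lemma negProj_surjective (p : XW f₀ L) : Function.Surjective (negProj f₀ L p) := by
  obtain ⟨k, hk⟩ := exists_rep_ne p.1.x
  obtain ⟨i, hi⟩ := exists_omitProd_ne_of_mem p
  intro D
  exact ⟨_, (relTangent_eq_sum (q := Set.inclusion (XW_subset f₀ L) p) hk D).trans
    (negProj_sum_liftField hk hi _).symm |>.symm⟩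

/-! ### The subbundle `G(1)` -/

lemma applyVec_partialA_affineCoord {m : ℕ} (p : (Set.univ : Set (AffProj m n))) (i l : Fin m) :
    applyVec (partialA p i) (affineCoord _ l) = (Pi.single i 1 : Fin m → ℂ) l := by
  rw [applyVec_of_mem _ (affineCoord_mem p l)]
  change deriv (fun t : ℂ => (p.1.a + Pi.single i t : Fin m → ℂ) l) 0 = _
  by_cases hl : l = i
  · subst hl
    simp
  · simp [hl]

lemma applyVec_partialA_chartCoord {m : ℕ} {p : (Set.univ : Set (AffProj m n))} {k : Fin (n + 1)}
    (hk : p.1.x.rep k ≠ 0) (i : Fin m) (j : Fin (n + 1)) :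
    applyVec (partialA p i) (chartCoord _ k j) = 0 := by
  rw [applyVec_of_mem _ (chartCoord_mem p hk j)]
  exact deriv_const (0 : ℂ) (chartCoord _ k j p)

/-- The vector `c_0 ∂/∂a_0 - c_i ∂/∂a_i`. -/
def uVec (c : Fin (h + 1) → ℂ) (p : (Set.univ : Set (AffProj (h + 1) n))) (i : Fin h) :
    tangentSpace Set.univ p := c 0 • partialA p 0 - c i.succ • partialA p i.succ

lemma applyVec_uVec_affineCoord (c : Fin (h + 1) → ℂ) (p : (Set.univ : Set (AffProj (h + 1) n)))
    (i : Fin h) (l : Fin (h + 1)) : applyVec (uVec c p i) (affineCoord _ l) = uCoeff c i l := by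
  simp only [uVec, uCoeff, applyVec_sub, applyVec_smul, applyVec_partialA_affineCoord]
  rfl

lemma applyVec_uVec_chartCoord {p : (Set.univ : Set (AffProj (h + 1) n))} {k : Fin (n + 1)}
    (hk : p.1.x.rep k ≠ 0) (c : Fin (h + 1) → ℂ) (i : Fin h) (j : Fin (n + 1)) :
    applyVec (uVec c p i) (chartCoord _ k j) = 0 := by
  simp [uVec, applyVec_partialA_chartCoord hk]

/-- The values of the forms `L_i` relative to the generator `x_k` of `O(1)`. -/
def chartValues (L : Fin (h + 1) → Form n 1) (k : Fin (n + 1)) (x : ℙ ℂ (Fin (n + 1) → ℂ))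
    (i : Fin (h + 1)) : ℂ := eval x.rep (L i).1 / x.rep k

lemma formAt_eq_chartValues {x : ℙ ℂ (Fin (n + 1) → ℂ)} {k : Fin (n + 1)} (hk : x.rep k ≠ 0)
    (i : Fin (h + 1)) : formAt (L i) x = chartValues L k x i • formAt (varForm k) x := by
  have := lineFun_eq_smul (varForm_repVec_ne hk) (formAt (L i) x)
  rwa [formAt_repVec, formAt_repVec, eval_varForm] at this

lemma uField_eq {p : (Set.univ : Set (AffProj (h + 1) n))} {k : Fin (n + 1)}
    (hk : p.1.x.rep k ≠ 0) (i : Fin h) :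
    uField L p i = uVec (chartValues L k p.1.x) p i ⊗ₜ[ℂ] formAt (varForm k) p.1.x := by
  rw [uField, formAt_eq_chartValues (L := L) hk 0, formAt_eq_chartValues (L := L) hk i.succ, uVec, TensorProduct.sub_tmul,
    TensorProduct.smul_tmul, TensorProduct.smul_tmul]

lemma chartValues_ne {x : ℙ ℂ (Fin (n + 1) → ℂ)} (hx : x ∈ openW L) {k : Fin (n + 1)}
    (hk : x.rep k ≠ 0) (i j : Fin (h + 1)) (hij : i ≠ j) :
    chartValues L k x i ≠ 0 ∨ chartValues L k x j ≠ 0 :=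
  (eval_ne_of_mem_openW hx i j hij).imp (fun h => div_ne_zero h hk) fun h => div_ne_zero h hk

lemma prod_chartValues {x : ℙ ℂ (Fin (n + 1) → ℂ)} (k : Fin (n + 1)) (i : Fin (h + 1)) :
    ∏ j ∈ Finset.univ.erase i, chartValues L k x j = eval x.rep (omitProd L i).1 / x.rep k ^ h := by
  simp [chartValues, Finset.prod_div_distrib, eval_omitProd]

/-- The two sums differ by the nonzero factor `x_k ^ h`, since each `M_l` is a product of `h` linear
forms. -/
lemma sum_prod_chartValues {x : ℙ ℂ (Fin (n + 1) → ℂ)} {k : Fin (n + 1)} (hk : x.rep k ≠ 0)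
    (α : Fin (h + 1) → ℂ) :
    ∑ l, (∏ j ∈ Finset.univ.erase l, chartValues L k x j) * α l = 0 ↔
      ∑ l, eval x.rep (omitProd L l).1 * α l = 0 := by
  simp only [prod_chartValues, div_mul_eq_mul_div]
  rw [← Finset.sum_div, div_eq_zero_iff, or_iff_left (pow_ne_zero _ hk)]

/-- The image in `T(ℂ^(h+1) × ℙ^n)` of a tangent vector of `X_W` has the same coordinates. -/
lemma dIncl_univ_eq {p : XW f₀ L} {k : Fin (n + 1)} (hk : p.1.x.rep k ≠ 0)
    (D : tangentSpace (XW f₀ L) p)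
    (E : tangentSpace Set.univ (Set.inclusion (Set.subset_univ (XW f₀ L)) p))
    (ha : ∀ l, applyVec D (affineCoord _ l) = applyVec E (affineCoord _ l))
    (hx : ∀ j, applyVec D (chartCoord _ k j) = applyVec E (chartCoord _ k j)) :
    dIncl (Set.subset_univ (XW f₀ L)) p D = E := by
  refine tangent_ext (S := Set.univ) (p := Set.inclusion (Set.subset_univ (XW f₀ L)) p) (k := k) hk
    (fun l => ?_) fun j => ?_
  · rw [← ha l]
    exact applyVec_dIncl _ p D (affineCoord_mem _ l)
  · rw [← hx j]
    exact applyVec_dIncl _ p D (chartCoord_mem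
      (Set.inclusion (Set.subset_univ (XW f₀ L)) p) hk j)

/-- The coefficients of `u_i` satisfy `∑ M_l α_l = 0` because `L_0 M_0 = L_i M_i`, so
`exists_vertical_tangent_XW` realizes them on `X_W`. -/
lemma exists_dIncl_eq_uVec {p : XW f₀ L} {k : Fin (n + 1)} (hk : p.1.x.rep k ≠ 0) (i : Fin h) :
    ∃ D : tangentSpace (XW f₀ L) p, dIncl (Set.subset_univ (XW f₀ L)) p D =
      uVec (chartValues L k p.1.x) (Set.inclusion (Set.subset_univ (XW f₀ L)) p) i := by
  obtain ⟨l, hl⟩ := exists_omitProd_ne_of_mem p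
  obtain ⟨D, hDa, hDx⟩ := exists_vertical_tangent_XW (p := p) hk hl
    ((sum_prod_chartValues hk _).1 (sum_mul_uCoeff (chartValues L k p.1.x) i))
  refine ⟨D, dIncl_univ_eq hk D _ (fun l => ?_) fun j => ?_⟩
  · rw [hDa, applyVec_uVec_affineCoord]
  · rw [hDx, applyVec_uVec_chartCoord hk]

/-- The vertical vectors of `T X_W` are those in the span of the `u_i`. -/
lemma dIncl_mem_span_uVec_iff {p : XW f₀ L} {k : Fin (n + 1)} (hk : p.1.x.rep k ≠ 0)
    (D : tangentSpace (XW f₀ L) p) :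
    dIncl (Set.subset_univ (XW f₀ L)) p D ∈ Submodule.span ℂ (Set.range
      (uVec (chartValues L k p.1.x) (Set.inclusion (Set.subset_univ (XW f₀ L)) p))) ↔
      negProj f₀ L p D = 0 := by
  obtain ⟨i, hi⟩ := exists_omitProd_ne_of_mem p
  rw [negProj_eq_zero_iff hk]
  constructor
  · intro hD j
    rw [Submodule.mem_span_range_iff_exists_fun] at hD
    obtain ⟨c, hc⟩ := hD
    have := applyVec_dIncl (Set.subset_univ (XW f₀ L)) p D
      (chartCoord_mem (Set.inclusion (Set.subset_univ (XW f₀ L)) p) hk j)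
    refine this.symm.trans ?_
    rw [← hc, applyVec_sum]
    exact Finset.sum_eq_zero fun l _ => by
      rw [applyVec_smul, applyVec_uVec_chartCoord hk, mul_zero]
  · intro hD
    -- The `a`-components of `D` solve the linear equation of `X_W`, hence are a combination of the
    -- coefficient vectors of the `u_i`. The same combination of the `u_i` has the coordinates of
    -- `D`, hence is its image.
    have h1 := (sum_prod_chartValues hk _).2 (sum_omitProd_mul_eq_zero hk hD hi)
    have h2 : ∏ j ∈ Finset.univ.erase i, chartValues L k p.1.x j ≠ 0 := by
      rw [prod_chartValues]
      exact div_ne_zero hi (pow_ne_zero _ hk)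
    have h3 := mem_span_uCoeff (chartValues_ne p.2.1.2 hk) h2 h1
    rw [Submodule.mem_span_range_iff_exists_fun] at h3 ⊢
    obtain ⟨c, hc⟩ := h3
    refine ⟨c, (dIncl_univ_eq hk D _ (fun l => ?_) fun j => ?_).symm⟩
    · rw [applyVec_sum, ← congrFun hc l]
      simp [applyVec_uVec_affineCoord]
    · rw [hD, applyVec_sum]
      exact (Finset.sum_eq_zero fun l _ => by
        rw [applyVec_smul, applyVec_uVec_chartCoord hk, mul_zero]).symm

lemma span_uField {p : (Set.univ : Set (AffProj (h + 1) n))} {k : Fin (n + 1)}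
    (hk : p.1.x.rep k ≠ 0) : Submodule.span ℂ (Set.range (uField L p)) =
      (Submodule.span ℂ (Set.range (uVec (chartValues L k p.1.x) p))).map
        (twistEquiv (tangentSpace Set.univ p) _ (varForm_repVec_ne hk)).toLinearMap := by
  rw [Submodule.map_span, ← Set.range_comp]
  congr 2
  ext i
  exact uField_eq hk i

variable (f₀ L) in
/-- The twist of `negProj`. -/
def negProjTwist (p : XW f₀ L) : (TXW1 f₀ L).fibre p →ₗ[ℂ] (TWA1 f₀ L).fibre p :=
  LinearMap.rTensor (lineFun 1 p.1.x) (negProj f₀ L p)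

lemma negProjTwist_tmul (p : XW f₀ L) (D : tangentSpace (XW f₀ L) p) (ζ : lineFun 1 p.1.x) :
    negProjTwist f₀ L p (D ⊗ₜ[ℂ] ζ : tangentSpace (XW f₀ L) p ⊗[ℂ] lineFun 1 p.1.x) =
      (negProj f₀ L p D ⊗ₜ[ℂ] ζ : relTangentSpace AffProj.a (prodAW f₀ L)
        (Set.inclusion (XW_subset f₀ L) p) ⊗[ℂ] lineFun 1 p.1.x) := rfl

lemma negProjTwist_surjective (p : XW f₀ L) : Function.Surjective (negProjTwist f₀ L p) :=
  LinearMap.rTensor_surjective _ (negProj_surjective p)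

/-- Trivializing `O(1)` by `x_k` reduces this to `dIncl_mem_span_uVec_iff`. -/
lemma G1_eq_ker (p : XW f₀ L) : G1 f₀ L p = (negProjTwist f₀ L p).ker := by
  obtain ⟨k, hk⟩ := exists_rep_ne p.1.x
  ext τ
  obtain ⟨D, rfl⟩ := exists_eq_tmul (V := tangentSpace (XW f₀ L) p) (varForm_repVec_ne hk) τ
  have h1 : (negProj f₀ L p D ⊗ₜ[ℂ] formAt (varForm k) p.1.x : relTangentSpace AffProj.a
      (prodAW f₀ L) (Set.inclusion (XW_subset f₀ L) p) ⊗[ℂ] lineFun 1 p.1.x) = 0 ↔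
      negProj f₀ L p D = 0 :=
    (twistEquiv (relTangentSpace AffProj.a (prodAW f₀ L) (Set.inclusion (XW_subset f₀ L) p)) _
      (varForm_repVec_ne hk)).map_eq_zero_iff
  refine Iff.trans ?_ h1.symm
  rw [← dIncl_mem_span_uVec_iff hk]
  change (twistEquiv (tangentSpace Set.univ (Set.inclusion (Set.subset_univ (XW f₀ L)) p)) _
    (varForm_repVec_ne hk)) (dIncl (Set.subset_univ (XW f₀ L)) p D) ∈
      Submodule.span ℂ (Set.range (uField L (Set.inclusion (Set.subset_univ (XW f₀ L)) p))) ↔ _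
  rw [span_uField (p := Set.inclusion (Set.subset_univ (XW f₀ L)) p) hk]
  exact (Submodule.mem_map_equiv _).trans (by rw [LinearEquiv.symm_apply_apply])

lemma inclTotal_injective (p : XW f₀ L) : Function.Injective (inclTotal f₀ L p) := by
  obtain ⟨k, hk⟩ := exists_rep_ne p.1.x
  intro τ τ' hτ
  obtain ⟨D, rfl⟩ := exists_eq_tmul (V := tangentSpace (XW f₀ L) p) (varForm_repVec_ne hk) τ
  obtain ⟨D', rfl⟩ := exists_eq_tmul (V := tangentSpace (XW f₀ L) p) (varForm_repVec_ne hk) τ'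
  have := tmul_right_injective (V := tangentSpace Set.univ (Set.inclusion
    (Set.subset_univ (XW f₀ L)) p)) (varForm_repVec_ne hk) hτ
  obtain rfl : D = D' := dIncl_injective _ p this
  rfl

lemma exists_inclTotal_eq_uField (p : XW f₀ L) (i : Fin h) : ∃ τ, inclTotal f₀ L p τ =
    uField L (Set.inclusion (Set.subset_univ (XW f₀ L)) p) i := by
  obtain ⟨k, hk⟩ := exists_rep_ne p.1.x
  obtain ⟨D, hD⟩ := exists_dIncl_eq_uVec (p := p) hk i
  refine ⟨(D ⊗ₜ[ℂ] formAt (varForm k) p.1.x :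
    tangentSpace (XW f₀ L) p ⊗[ℂ] lineFun 1 p.1.x), ?_⟩
  rw [uField_eq (p := Set.inclusion (Set.subset_univ (XW f₀ L)) p) hk i]
  exact congrArg (· ⊗ₜ[ℂ] formAt (varForm k) p.1.x) hD

/-- In the trivialization by `x_k`, the values on the `a_l` send the `u_i` to the vectors `uCoeff`,
which are independent over `W`. -/
lemma linearIndependent_uField {p : (Set.univ : Set (AffProj (h + 1) n))}
    (hp : p.1.x ∈ openW L) : LinearIndependent ℂ (uField L p) := by
  obtain ⟨k, hk⟩ := exists_rep_ne p.1.x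
  let e := twistEquiv (tangentSpace Set.univ p) _ (varForm_repVec_ne hk)
  let φ : tangentSpace Set.univ p →ₗ[ℂ] (Fin (h + 1) → ℂ) :=
    LinearMap.pi fun l => applyVecₗ p (affineCoord _ l)
  let u : Fin h → tangentSpace Set.univ p ⊗[ℂ] lineFun 1 p.1.x :=
    fun i => e (uVec (chartValues L k p.1.x) p i)
  have he : (φ ∘ₗ e.symm.toLinearMap) ∘ u = uCoeff (chartValues L k p.1.x) := by
    ext i l
    change φ (e.symm (e _)) l = _
    rw [e.symm_apply_apply]
    exact applyVec_uVec_affineCoord _ _ i l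
  have hu : LinearIndependent ℂ u := by
    refine LinearIndependent.of_comp (φ ∘ₗ e.symm.toLinearMap) ?_
    rw [he]
    exact linearIndependent_uCoeff (chartValues_ne hp hk)
  have hu' : uField L p = u := funext fun i => uField_eq hk i
  rw [hu']
  exact hu

/-- `G(1)` is defined as a preimage, which could be smaller than the span of the `u_i`; since every
`u_i` is tangent to `X_W`, it maps isomorphically onto that span. -/
theorem finrank_G1 (p : XW f₀ L) : Module.finrank ℂ (G1 f₀ L p) = h := by
  have h1 : (G1 f₀ L p).map (inclTotal f₀ L p) = Submodule.span ℂ (Set.range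
      (uField L (Set.inclusion (Set.subset_univ (XW f₀ L)) p))) := by
    refine Submodule.map_comap_eq_of_le (Submodule.span_le.2 ?_)
    rintro _ ⟨i, rfl⟩
    exact exists_inclTotal_eq_uField p i
  refine (Submodule.equivMapOfInjective _ (inclTotal_injective p) _).finrank_eq.trans ?_
  rw [h1, finrank_span_eq_card (linearIndependent_uField (p := Set.inclusion (Set.subset_univ (XW f₀ L)) p) p.2.1.2), Fintype.card_fin]

lemma isRegAt_TXW1_iff {p : XW f₀ L} {k : Fin (n + 1)} (hk : p.1.x.rep k ≠ 0)
    (r : ∀ q, (TXW1 f₀ L).fibre q) :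
    (TXW1 f₀ L).IsRegAt p r ↔ ∃ s : ∀ q, tangentSpace (XW f₀ L) q,
      (tangentBundle (XW f₀ L)).IsRegAt p s ∧ ∀ᶠ q in 𝓝 p,
        r q = (s q ⊗ₜ[ℂ] formAt (varForm k) q.1.x :
          tangentSpace (XW f₀ L) q ⊗[ℂ] lineFun 1 q.1.x) :=
  twist_isRegAt_iff (tangentBundle_hasRegularModule _) hk r

open Classical in
-- The lift of `u_i` to `T X_W(1)` is unique because `inclTotal` is injective. So the pointwise
-- choice agrees near each point with a field in a chart whose coordinates are `0` and multiples of
-- `L_j / x_k`, hence regular.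
theorem exists_regular_uField (i : Fin h) :
    ∃ s : ∀ p, (TXW1 f₀ L).fibre p, (∀ p, (TXW1 f₀ L).IsRegAt p s) ∧
      ∀ p, inclTotal f₀ L p (s p) =
        uField L (Set.inclusion (Set.subset_univ (XW f₀ L)) p) i := by
  choose s hs using fun p : XW f₀ L => exists_inclTotal_eq_uField p i
  refine ⟨s, fun p => ?_, hs⟩
  obtain ⟨k, hk⟩ := exists_rep_ne p.1.x
  let D : ∀ q, tangentSpace (XW f₀ L) q := fun q =>
    if hq : q.1.x.rep k ≠ 0 then (exists_dIncl_eq_uVec hq i).choose else 0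
  have hD (q : XW f₀ L) (hq : q.1.x.rep k ≠ 0) : dIncl (Set.subset_univ (XW f₀ L)) q (D q) =
      uVec (chartValues L k q.1.x) (Set.inclusion (Set.subset_univ (XW f₀ L)) q) i := by
    simp only [D, dif_pos hq]
    exact (exists_dIncl_eq_uVec hq i).choose_spec
  refine (isRegAt_TXW1_iff hk s).2 ⟨D, isRegAt_of_coords hk (fun l => ?_) fun j => ?_, ?_⟩
  · have hv (i : Fin (h + 1)) : IsRegularAt (XW f₀ L) p fun q => chartValues L k q.1.x i := by
      have := formRatio_mem p (L i) (varForm k) (by simpa using hk)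
      unfold formRatio at this
      simp only [eval_varForm] at this
      exact this
    refine (((hv 0).mul (isRegularAt_const p ((Pi.single 0 1 : Fin (h + 1) → ℂ) l))).add
      ((hv i.succ).mul (isRegularAt_const p ((Pi.single i.succ 1 : Fin (h + 1) → ℂ) l))).neg).congr ?_
    filter_upwards [eventually_rep_ne p hk] with q hq
    have := applyVec_dIncl (Set.subset_univ (XW f₀ L)) q (D q) (affineCoord_mem _ l)
    rw [hD q hq, applyVec_uVec_affineCoord] at this
    refine Eq.trans ?_ this
    simp [uCoeff, sub_eq_add_neg]
  · refine (isRegularAt_const p 0).congr ?_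
    filter_upwards [eventually_rep_ne p hk] with q hq
    have := applyVec_dIncl (Set.subset_univ (XW f₀ L)) q (D q)
      (chartCoord_mem (Set.inclusion (Set.subset_univ (XW f₀ L)) q) hq j)
    rw [hD q hq, applyVec_uVec_chartCoord hq] at this
    exact this
  · filter_upwards [eventually_rep_ne p hk] with q hq
    refine inclTotal_injective q ((hs q).trans ?_)
    rw [uField_eq (p := Set.inclusion (Set.subset_univ (XW f₀ L)) q) hq i]
    exact congrArg (· ⊗ₜ[ℂ] formAt (varForm k) q.1.x) (hD q hq).symm

/-! ### The isomorphism and its compatibilities -/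

variable (f₀ L) in
/-- The fibres of the isomorphism. -/
def quotEquiv (p : XW f₀ L) :
    ((TXW1 f₀ L).fibre p ⧸ G1 f₀ L p) ≃ₗ[ℂ] (TWA1 f₀ L).fibre p :=
  (Submodule.quotEquivOfEq _ _ (G1_eq_ker p)).trans
    ((negProjTwist f₀ L p).quotKerEquivOfSurjective (negProjTwist_surjective p))

lemma quotEquiv_mk (p : XW f₀ L) (τ : (TXW1 f₀ L).fibre p) :
    quotEquiv f₀ L p (Submodule.Quotient.mk τ) = negProjTwist f₀ L p τ := rfl

/-- The image of the class of `D ⊗ x_k` has coefficients `-D(y_j)` in the frame, which are regular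
if `D` is. Conversely, a section with coefficients `g_j` is the image of `-∑ g_j` times the lifts of
`∂/∂y_j`, which are regular; the class agrees because the fibre maps are injective. -/
lemma quot_isRegAt_iff (p : XW f₀ L) (s : ∀ q, (TXW1 f₀ L).fibre q ⧸ G1 f₀ L q) :
    ((TXW1 f₀ L).quot (G1 f₀ L)).IsRegAt p s ↔
      (TWA1 f₀ L).IsRegAt p (fun q => quotEquiv f₀ L q (s q)) := by
  obtain ⟨k, hk⟩ := exists_rep_ne p.1.x
  obtain ⟨i, hi⟩ := exists_omitProd_ne_of_mem p
  rw [TWA1_isRegAt_iff hk]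
  constructor
  · rintro ⟨t, ht, hst⟩
    obtain ⟨D, hD, htD⟩ := (isRegAt_TXW1_iff hk t).1 ht
    refine ⟨fun j q => -applyVec (D q) (chartCoord _ k (k.succAbove j)),
      fun j => (isRegularAt_applyVec hD (chartCoord_mem p hk _)).neg, ?_⟩
    filter_upwards [hst, htD, eventually_rep_ne p hk] with q h1 h2 h3
    rw [h1, quotEquiv_mk, h2, negProjTwist_tmul]
    refine (tmul_eq_sum_chartFrame h3 _).trans (Finset.sum_congr rfl fun j _ => ?_)
    rw [negProj_chartCoord h3]
  · rintro ⟨g, hg, hs⟩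
    let D : ∀ q, tangentSpace (XW f₀ L) q := fun q => ∑ j, (-g j q) • liftField f₀ L k i j q
    have hD : (tangentBundle (XW f₀ L)).IsRegAt p D :=
      (tangentBundle_hasRegularModule _).sum (fun j => (hg j).neg)
        fun j => isRegAt_liftField hk hi j
    refine ⟨fun q => (D q ⊗ₜ[ℂ] formAt (varForm k) q.1.x :
      tangentSpace (XW f₀ L) q ⊗[ℂ] lineFun 1 q.1.x), (isRegAt_TXW1_iff hk _).2
        ⟨D, hD, Eventually.of_forall fun _ => rfl⟩, ?_⟩
    filter_upwards [hs, eventually_rep_ne p hk, eventually_eval_ne p _ hi] with q h1 h2 h3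
    refine (quotEquiv f₀ L q).injective (h1.trans ?_)
    refine Eq.trans ?_ (tmul_eq_sum_chartFrame h2 (negProj f₀ L q (D q))).symm
    refine Finset.sum_congr rfl fun j _ => ?_
    rw [negProj_sum_liftField h2 h3 fun j => g j q]
    exact congrArg (· • chartFrame f₀ L k j q) (applyVec_sum_chartField
      (q := Set.inclusion (XW_subset f₀ L) q) h2 (fun j => g j q) j).symm

variable (f₀ L) in
/-- The isomorphism `T X_W(1) / G(1) ≅ T_{W/A}(1)`. -/
def quotIso : RegBundle.Iso ((TXW1 f₀ L).quot (G1 f₀ L)) (TWA1 f₀ L) where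
  equiv := quotEquiv f₀ L
  isRegAt_iff := quot_isRegAt_iff

lemma inclAW_add_inclW_mem (p : XW f₀ L) (τ : (TXW1 f₀ L).fibre p) :
    inclAW f₀ L p τ + inclW f₀ L p (negProjTwist f₀ L p τ) ∈ LinearMap.range (inclA f₀ L p) := by
  obtain ⟨k, hk⟩ := exists_rep_ne p.1.x
  obtain ⟨D, rfl⟩ := exists_eq_tmul (V := tangentSpace (XW f₀ L) p) (varForm_repVec_ne hk) τ
  refine ⟨((⟨_, dIncl_add_negProj_mem p D⟩ : relTangentSpace AffProj.x (prodAW f₀ L)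
    (Set.inclusion (XW_subset f₀ L) p)) ⊗ₜ[ℂ] formAt (varForm k) p.1.x :
      relTangentSpace AffProj.x (prodAW f₀ L) (Set.inclusion (XW_subset f₀ L) p) ⊗[ℂ]
        lineFun 1 p.1.x), ?_⟩
  exact TensorProduct.add_tmul _ _ _

/-- At `a = 0`, `applyVec_equation` says `-D(f_0 / Q) = ∑ D(a_l) M_l / Q`. The left side is the
value of `negProj` at `f_0 / Q`; multiplying by `Q` gives an equality in `O(h)`, whichever
trivialization `Q` is used. -/
lemma nuOne_negProj {p : XW f₀ L} (hp : p.1.a = 0) (Q : Form n h)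
    (hQ : eval p.1.x.rep Q.1 ≠ 0) (D : tangentSpace (XW f₀ L) p) :
    nuOne f₀ L p Q hQ (negProj f₀ L p D) = muOne f₀ L p D := by
  have h1 : nuOne f₀ L p Q hQ (negProj f₀ L p D) =
      applyVec (negProj f₀ L p D).1 (formRatio _ f₀ Q) • formAt Q p.1.x := by
    rw [applyVec_of_mem _ (formRatio_mem (Set.inclusion (XW_subset f₀ L) p) f₀ Q hQ)]
    rfl
  have h2 : muOne f₀ L p D =
      ∑ i, applyVec D (affineCoord _ i) • formAt (omitProd L i) p.1.x := by
    change ∑ i, D.1 (coordA (XW f₀ L) p i) • formAt (omitProd L i) p.1.x = _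
    refine Finset.sum_congr rfl fun i _ => ?_
    rw [applyVec_of_mem D (affineCoord_mem p i)]
    rfl
  have h3 := applyVec_equation D Q hQ
  rw [h1, h2, negProj_formRatio D f₀ Q hQ]
  have h4 (i : Fin (h + 1)) : formAt (omitProd L i) p.1.x =
      (eval p.1.x.rep (omitProd L i).1 / eval p.1.x.rep Q.1) • formAt Q p.1.x :=
    lineFun_eq_smul (ζ := formAt Q p.1.x) hQ _
  simp only [hp, Pi.zero_apply, zero_mul, zero_add] at h3
  simp only [h4, smul_smul]
  rw [← Finset.sum_smul]
  congr 1
  simp only [mul_comm (applyVec D _)]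
  linear_combination -h3

lemma nu_negProjTwist {p : XW f₀ L} (hp : p.1.a = 0) (Q : Form n h)
    (hQ : eval p.1.x.rep Q.1 ≠ 0) (τ : (TXW1 f₀ L).fibre p) :
    nu f₀ L p Q hQ (negProjTwist f₀ L p τ) = mu f₀ L p τ := by
  obtain ⟨k, hk⟩ := exists_rep_ne p.1.x
  obtain ⟨D, rfl⟩ := exists_eq_tmul (V := tangentSpace (XW f₀ L) p) (varForm_repVec_ne hk) τ
  exact congrArg (fun s => lineMul h 1 s (formAt (varForm k) p.1.x)) (nuOne_negProj hp Q hQ D)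

end Family

end ClemensFamily

end

theorem theorem2p1 (n h : ℕ) (f₀ : Form n h) (L : Fin (h + 1) → Form n 1)
    (hf₀ : IsSmoothForm f₀.1) (hL : ∀ i, L i ≠ 0)
    (hdiv : ∀ i j, i ≠ j → projZeros (L i) ≠ projZeros (L j)) :
    -- the `u_i` are tangent to `X_W`, regular there, and span a subbundle of rank `h`
    (∀ i : Fin h, ∃ s : ∀ p, (TXW1 f₀ L).fibre p, (∀ p, (TXW1 f₀ L).IsRegAt p s) ∧
      ∀ p, inclTotal f₀ L p (s p) =
        uField L (Set.inclusion (Set.subset_univ (XW f₀ L)) p) i) ∧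
    (∀ p, Module.finrank ℂ (G1 f₀ L p) = h) ∧
    -- `T_{W/A}(1)` is a vector bundle of rank `n` on `X_W`, isomorphic to `T X_W(1) / G(1)`
    (TWA1 f₀ L).IsLocallyFree n ∧
    ∃ I : RegBundle.Iso ((TXW1 f₀ L).quot (G1 f₀ L)) (TWA1 f₀ L),
      -- `I` maps the class of `τ = α + v`, with `α` along `A` and `v` along `W`, to `-v`
      (∀ (p : XW f₀ L) (τ : (TXW1 f₀ L).fibre p),
        inclAW f₀ L p τ + inclW f₀ L p (I.equiv p (Submodule.Quotient.mk τ)) ∈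
          LinearMap.range (inclA f₀ L p)) ∧
      -- over `{f₀} × f₀^W` the differential maps to `O(h + 1)` correspond under `I`
      (∀ (p : XW f₀ L), p.1.a = 0 →
        ∀ (Q : Form n h) (hQ : MvPolynomial.eval p.1.x.rep Q.1 ≠ 0) (τ : (TXW1 f₀ L).fibre p),
          nu f₀ L p Q hQ (I.equiv p (Submodule.Quotient.mk τ)) = mu f₀ L p τ) := by
  exact ⟨exists_regular_uField, finrank_G1, TWA1_isLocallyFree, quotIso f₀ L,
    fun p τ => inclAW_add_inclW_mem p τ, fun p hp Q hQ τ => nu_negProjTwist hp Q hQ τ⟩
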